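/- **Setting.** Let $d\ge 1$, let $W\subset\mathbb R^d$ be compact and convex with volume $V(W)>0$, and let $(\delta_t)_{t>0}$ be positive real numbers with $\delta_t\to0$ as $t\to\infty$. For each $t>0$ let $\eta_t$ be a homogeneous Poisson point process of intensity $t$ in $W$, i.e. a random finite set of distinct points of $W$ with $\mathbb P(\eta_t(A)=0)=e^{-t\lambda(A)}$ for every Borel set $A\subset W$, where $\eta_t(A)$ is the number of points in $A$ and $\lambda$ is Lebesgue measure. For $\alpha\in\mathbb R$ put $$L_t^{(\alpha)}=\frac12\sum_{(x,y)\in\eta_t\times\eta_t,\;x\ne y}\mathbf 1(\|x-y\|\le\delta_t)\,\|x-y\|^\alpha .$$ Let $\kappa_j$ be the volume of the unit ball in $\mathbb R^j$, $B(0,r)$ the ball of radius $r$ centred at the origin in $\mathbb R^d$, $g_W(y)=V(W\cap(W+y))$ the covariogram of $W$, and $S(W)=\lim_{\varepsilon\downarrow0}\varepsilon^{-1}\bigl(V(W+B(0,\varepsilon))-V(W)\bigr)$ the surface area of $W$. **Theorem.** Let $\alpha>-d$. Then for every $t>0$ the random variable $L_t^{(\alpha)}$ is integrable and $$\mathbb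 E L_t^{(\alpha)}=\frac{t^2}{2}\int_{B(0,\delta_t)}\|y\|^\alpha g_W(y)\,dy,$$ where the integral on the right converges, and $$\frac{d\kappa_d}{2(\alpha+d)}t^2\delta_t^{\alpha+d}V(W)-\frac{\kappa_{d-1}}{2(\alpha+d+1)}t^2\delta_t^{\alpha+d+1}S(W)\;\le\;\mathbb E L_t^{(\alpha)}\;\le\;\frac{d\kappa_d}{2(\alpha+d)}t^2\delta_t^{\alpha+d}V(W).$$ Moreover, $$\mathbb E L_t^{(\alpha)}=\frac{d\kappa_d}{2(\alpha+d)}t^2\delta_t^{\alpha+d}V(W)\,\bigl(1+O(\delta_t)\bigr)\qquad(t\to\infty),$$ where $O(\delta_t)$ stands for a function $R(t)$ such that $R(t)/\delta_t$ converges to a real number as $t\to\infty$ (so that, in particular, $R(t)=O(\delta_t)$ in the usual sense). -/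

import Mathlib

open MeasureTheory Filter Topology
open scoped Pointwise ENNReal

namespace Gilbert

noncomputable section

/-- The volume `κ_j` of the `j`-dimensional Euclidean unit ball. -/
def kappa (j : ℕ) : ℝ :=
  volume.real (Metric.closedBall (0 : EuclideanSpace ℝ (Fin j)) 1)

/-- The covariogram `g_W(y) = V(W ∩ (W + y))`. -/
def covariogram {d : ℕ} (W : Set (EuclideanSpace ℝ (Fin d))) (y : EuclideanSpace ℝ (Fin d)) : ℝ :=
  volume.real (W ∩ (fun x => x + y) '' W)

/-- The surface area of a convex body in Minkowski's sense: the right derivative at `ε = 0` of the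
volume `V(W + ε B)` of the parallel body, `B` being the closed unit ball. For convex bodies
`V(W + ε B)` is a polynomial in `ε`, so the difference quotient converges to a finite limit, which
the lower limit computes. -/
def surfaceArea {d : ℕ} (W : Set (EuclideanSpace ℝ (Fin d))) : ℝ :=
  (liminf (fun ε : ℝ =>
    (volume (W + Metric.closedBall (0 : EuclideanSpace ℝ (Fin d)) ε) - volume W)
      / ENNReal.ofReal ε) (𝓝[>] 0)).toReal

/-- Finite configurations of distinct points of `W`. -/
def PointConfig {d : ℕ} (W : Set (EuclideanSpace ℝ (Fin d))) : Type :=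
  {s : Finset (EuclideanSpace ℝ (Fin d)) // (s : Set (EuclideanSpace ℝ (Fin d))) ⊆ W}

/-- The number `η(A)` of points of the configuration `η` in the set `A`. -/
def PointConfig.count {d : ℕ} {W : Set (EuclideanSpace ℝ (Fin d))} (η : PointConfig W)
    (A : Set (EuclideanSpace ℝ (Fin d))) : ℕ :=
  ((η.1 : Set (EuclideanSpace ℝ (Fin d))) ∩ A).ncard

/-- The σ-field generated by the evaluation maps `η ↦ η(A)`, for `A ⊆ W` Borel. -/
instance PointConfig.instMeasurableSpace {d : ℕ} (W : Set (EuclideanSpace ℝ (Fin d))) :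
    MeasurableSpace (PointConfig W) :=
  ⨆ A : {A : Set (EuclideanSpace ℝ (Fin d)) // MeasurableSet A ∧ A ⊆ W},
    MeasurableSpace.comap (fun η : PointConfig W => η.count A.1) ⊤

/-- `η` is a homogeneous Poisson point process of intensity `t` in `W`: a random finite
configuration of distinct points of `W` with `ℙ(η(A) = 0) = exp (-t λ(A))` for Borel `A ⊆ W`. -/
structure IsPoissonProcess {d : ℕ} {Ω : Type*} [MeasurableSpace Ω] (P : Measure Ω)
    (W : Set (EuclideanSpace ℝ (Fin d))) (t : ℝ) (η : Ω → PointConfig W) : Prop where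
  measurable : Measurable η
  void_prob : ∀ A : Set (EuclideanSpace ℝ (Fin d)), MeasurableSet A → A ⊆ W →
    P.real {ω | (η ω).count A = 0} = Real.exp (-(t * volume.real A))

open Classical in
/-- The length-power functional: half the sum over all ordered pairs of distinct points `x, y` of
the configuration with `‖x - y‖ ≤ r` of `‖x - y‖ ^ α`. -/
def lengthPower {d : ℕ} {W : Set (EuclideanSpace ℝ (Fin d))} (α r : ℝ) (η : PointConfig W) : ℝ :=
  (1 / 2) * ∑ p ∈ η.1.offDiag, if ‖p.1 - p.2‖ ≤ r then ‖p.1 - p.2‖ ^ α else 0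

/-- The Landau relation `g = O(h)` as `t → ∞`, in the strong form that `g(t) / h(t)` converges to
a real number. -/
def LandauO (g h : ℝ → ℝ) : Prop :=
  ∃ c : ℝ, Tendsto (fun t => g t / h t) atTop (𝓝 c)

end

end Gilbert

/-!
The expectation is a second moment of the process, the geometry enters through the covariogram near
the origin.

*The second moment.* Void probabilities give, by inclusion-exclusion, the probability that two
disjoint sets are both hit (`IsPoissonProcess.hit_prob`). Cut `W` into cubical cells of mesh `1 / n`
and count pairs of different cells such that the first is hit in `A` and the second in `B`. This
number never exceeds the number of pairs of distinct points in `A × B` and equals it for large `n`,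
so its expectation, which is explicit, determines the second factorial moment measure: it is
`t ^ 2` times Lebesgue measure on `W × W` (`IsPoissonProcess.lintegral_sum_offDiag`). Integrating a
function of `x - y` against it produces the covariogram (`IsPoissonProcess.integral_lengthPower`).

*The covariogram.* Let `shade W y` be the volume of `(W + [0, y]) \ W`. By convexity it is linear
along rays (`shade_smul`) and monotone in `W` (`shade_mono`), and it dominates
`deficit W y = V(W) - g_W(y)`. The upper bound of the theorem is `0 ≤ deficit`, the lower bound
follows from the inequality half of Cauchy's surface area formula,
`∫ shade W u du ≤ κ_{d-1} S(W)` over the unit sphere. The latter is proved without slicing. A point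
`x` at distance `s > 0` from a convex body `K` lies in `K + [0, ε y]` only if `s ≤ ε ⟪y, n⟫`, with
`n` the outer normal at the nearest point of `K`. By Fubini and rotation invariance the mean of
`shade K (ε y)` over the unit ball is at most the mean of the volumes of the shells of thickness
`ε ⟪y, e⟫⁺` around `K`, with a fixed unit vector `e` (`lintegral_sweep_diff_le`). For `K` running
through the parallel bodies `W + s B`, `0 < s ≤ T`, the left side only grows, and the right side
telescopes when integrated over `s`. As `ε → 0` this bounds the mean of `shade W` by a constant
times `(V(W + T B) - V(W)) / T` for every `T > 0` (`lintegral_shade_le_parallelVolume`), hence by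
the surface area. The constant is `∫ ⟪u, e⟫⁺ du = κ_{d-1}`, computed with a Gaussian weight
(`lintegral_sphere_posPart_coord`).

*The order of the error.* Along each ray the deficit is subadditive and bounded by the linear
function `shade`, so it has a right derivative at `0`; dominated convergence then gives the limit of
the rescaled error term (`exists_tendsto_integral_deficit_div`).
-/

namespace Gilbert

/-! ### Counting pairs of points -/

open Classical in
/-- The number of ordered pairs of distinct points of `s`, as a measure on the product space. -/
noncomputable def pairMeasure {E : Type*} [MeasurableSpace E] (s : Finset E) : Measure (E × E) :=
  ∑ p ∈ s.offDiag, Measure.dirac p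

instance {E : Type*} [MeasurableSpace E] (s : Finset E) : IsFiniteMeasure (pairMeasure s) := by
  unfold pairMeasure; infer_instance

open Classical in
lemma lintegral_pairMeasure {E : Type*} [MeasurableSpace E] (s : Finset E) {f : E × E → ℝ≥0∞}
    (hf : Measurable f) : ∫⁻ p, f p ∂(pairMeasure s) = ∑ p ∈ s.offDiag, f p := by
  unfold pairMeasure
  rw [lintegral_finsetSum_measure]
  exact Finset.sum_congr rfl fun p _ => lintegral_dirac' p hf

lemma pairMeasure_apply {E : Type*} [MeasurableSpace E] (s : Finset E) {C : Set (E × E)}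
    (hC : MeasurableSet C) :
    pairMeasure s C = (({p | p.1 ∈ s ∧ p.2 ∈ s ∧ p.1 ≠ p.2} ∩ C).encard : ℝ≥0∞) := by
  classical
  have h : pairMeasure s C = ∑ p ∈ s.offDiag, C.indicator 1 p := by
    unfold pairMeasure
    rw [Measure.finsetSum_apply]
    exact Finset.sum_congr rfl fun p _ => Measure.dirac_apply' p hC
  have h2 : ({p | p.1 ∈ s ∧ p.2 ∈ s ∧ p.1 ≠ p.2} ∩ C) =
      (s.offDiag.filter (· ∈ C) : Set (E × E)) := by
    ext p; simp [Finset.mem_offDiag]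
  rw [h, h2, Set.encard_coe_eq_coe_finsetCard, Finset.card_filter]
  simp [Set.indicator_apply]

lemma pairMeasure_prod {E : Type*} [MeasurableSpace E] (s : Finset E) {A B : Set E}
    (hA : MeasurableSet A) (hB : MeasurableSet B) :
    pairMeasure s (A ×ˢ B) =
      ((((s : Set E) ∩ A).ncard * ((s : Set E) ∩ B).ncard - ((s : Set E) ∩ (A ∩ B)).ncard : ℕ) :
        ℝ≥0∞) := by
  classical
  rw [pairMeasure_apply s (hA.prod hB)]
  have hfin : ({p : E × E | p.1 ∈ s ∧ p.2 ∈ s ∧ p.1 ≠ p.2} ∩ A ×ˢ B).Finite := by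
    refine (s ×ˢ s).finite_toSet.subset ?_
    rintro p ⟨⟨h1, h2, -⟩, -⟩
    simp [h1, h2]
  rw [← hfin.cast_ncard_eq]
  have hdiag : ((fun x : E => (x, x)) '' ((s : Set E) ∩ (A ∩ B))).ncard =
      ((s : Set E) ∩ (A ∩ B)).ncard :=
    Set.ncard_image_of_injective _ fun x y h => (Prod.ext_iff.1 h).1
  have key : ({p : E × E | p.1 ∈ s ∧ p.2 ∈ s ∧ p.1 ≠ p.2} ∩ A ×ˢ B) =
      (((s : Set E) ∩ A) ×ˢ ((s : Set E) ∩ B)) \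
        ((fun x : E => (x, x)) '' ((s : Set E) ∩ (A ∩ B))) := by
    ext ⟨x, y⟩
    simp only [Set.mem_inter_iff, Set.mem_ofPred_eq, Set.mem_prod, Set.mem_sdiff, Set.mem_image,
      Finset.mem_coe, Prod.mk.injEq, not_exists, not_and]
    constructor
    · rintro ⟨⟨h1, h2, h3⟩, h4, h5⟩
      exact ⟨⟨⟨h1, h4⟩, h2, h5⟩, fun z _ h h' => h3 (h.symm.trans h')⟩
    · rintro ⟨⟨⟨h1, h4⟩, h2, h5⟩, h⟩
      exact ⟨⟨h1, h2, fun h' => h x ⟨h1, h4, h' ▸ h5⟩ rfl h'⟩, h4, h5⟩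
  rw [key, Set.ncard_sdiff, hdiag, Set.ncard_prod]
  · norm_cast
  · rintro _ ⟨x, ⟨h1, h2, h3⟩, rfl⟩
    exact ⟨⟨h1, h2⟩, h1, h3⟩

variable {d : ℕ}

lemma PointConfig.count_inter {W : Set (EuclideanSpace ℝ (Fin d))} (η : PointConfig W)
    (A : Set (EuclideanSpace ℝ (Fin d))) : η.count (A ∩ W) = η.count A := by
  unfold PointConfig.count
  congr 1
  ext x
  have := @η.2 x
  simp only [Set.mem_inter_iff]
  tauto

lemma PointConfig.measurable_count {W : Set (EuclideanSpace ℝ (Fin d))} (hW : MeasurableSet W)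
    {A : Set (EuclideanSpace ℝ (Fin d))} (hA : MeasurableSet A) :
    Measurable fun η : PointConfig W => η.count A := by
  simp_rw [← PointConfig.count_inter _ A]
  have : Measurable[MeasurableSpace.comap (fun η : PointConfig W => η.count (A ∩ W)) ⊤]
      fun η : PointConfig W => η.count (A ∩ W) := comap_measurable _
  exact this.mono (le_iSup
    (fun A : {A : Set (EuclideanSpace ℝ (Fin d)) // MeasurableSet A ∧ A ⊆ W} =>
    MeasurableSpace.comap (fun η : PointConfig W => η.count A.1) ⊤)
      ⟨A ∩ W, hA.inter hW, Set.inter_subset_right⟩) le_rfl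

/-- The pair measure of a configuration is measurable, since its values on rectangles are
polynomials in the counts `η(A)`, `η(B)` and `η(A ∩ B)`. -/
lemma measurable_pairMeasure {W : Set (EuclideanSpace ℝ (Fin d))} (hW : MeasurableSet W) :
    Measurable fun η : PointConfig W => pairMeasure η.1 := by
  have hrect : ∀ A B : Set (EuclideanSpace ℝ (Fin d)), MeasurableSet A → MeasurableSet B →
      Measurable fun η : PointConfig W => pairMeasure η.1 (A ×ˢ B) := by
    intro A B hA hB
    simp_rw [pairMeasure_prod _ hA hB]
    have h : Measurable fun η : PointConfig W =>
        η.count A * η.count B - η.count (A ∩ B) :=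
      ((PointConfig.measurable_count hW hA).mul (PointConfig.measurable_count hW hB)).sub
        (PointConfig.measurable_count hW (hA.inter hB))
    exact measurable_from_top.comp h
  refine Measurable.measure_of_isPiSystem generateFrom_prod.symm isPiSystem_prod ?_ ?_
  · rintro _ ⟨A, hA, B, hB, rfl⟩
    exact hrect A B hA hB
  · rw [← Set.univ_prod_univ]
    exact hrect _ _ MeasurableSet.univ MeasurableSet.univ

/-! ### Void probabilities determine the second factorial moment -/

section PoissonMoments

variable {Ω : Type*} [MeasurableSpace Ω] {P : Measure Ω} [IsProbabilityMeasure P]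
  {W : Set (EuclideanSpace ℝ (Fin d))} {t : ℝ} {η : Ω → PointConfig W}

/-- Disjoint sets are hit independently: inclusion-exclusion from the void probabilities. -/
lemma IsPoissonProcess.hit_prob (hη : IsPoissonProcess P W t η) (hWc : IsCompact W)
    {A B : Set (EuclideanSpace ℝ (Fin d))} (hA : MeasurableSet A) (hB : MeasurableSet B)
    (hAW : A ⊆ W) (hBW : B ⊆ W) (hAB : Disjoint A B) :
    P.real {ω | (η ω).count A ≠ 0 ∧ (η ω).count B ≠ 0} =
      (1 - Real.exp (-(t * volume.real A))) * (1 - Real.exp (-(t * volume.real B))) := by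
  have hWm := hWc.measurableSet
  have m : ∀ C : Set (EuclideanSpace ℝ (Fin d)), MeasurableSet C →
      MeasurableSet {ω | (η ω).count C = 0} := fun C hC =>
    ((PointConfig.measurable_count hWm hC).comp hη.measurable) (measurableSet_singleton 0)
  have hfin : ∀ C ⊆ W, volume C ≠ ∞ := fun C hC =>
    ((measure_mono hC).trans_lt hWc.measure_lt_top).ne
  have hunion : {ω | (η ω).count (A ∪ B) = 0} =
      {ω | (η ω).count A = 0} ∩ {ω | (η ω).count B = 0} := by
    ext ω
    have hf : ∀ C, (((η ω).1 : Set (EuclideanSpace ℝ (Fin d))) ∩ C).Finite :=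
      fun C => (η ω).1.finite_toSet.inter_of_left C
    have hf' := hf (A ∪ B)
    simp only [PointConfig.count, Set.mem_ofPred_eq, Set.mem_inter_iff, Set.ncard_eq_zero (hf _),
      Set.inter_union_distrib_left] at hf' ⊢
    rw [Set.ncard_eq_zero hf', Set.union_empty_iff]
  have hcompl : {ω | (η ω).count A ≠ 0 ∧ (η ω).count B ≠ 0} =
      ({ω | (η ω).count A = 0} ∪ {ω | (η ω).count B = 0})ᶜ := by
    ext ω; simp
  have h1 := measureReal_union_add_inter (μ := P) (s := {ω | (η ω).count A = 0}) (m B hB)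
  rw [← hunion, hη.void_prob _ (hA.union hB) (Set.union_subset hAW hBW), hη.void_prob _ hA hAW,
    hη.void_prob _ hB hBW, measureReal_union hAB hB (hfin A hAW) (hfin B hBW)] at h1
  rw [hcompl, probReal_compl_eq_one_sub ((m A hA).union (m B hB))]
  have h2 : Real.exp (-(t * (volume.real A + volume.real B))) =
      Real.exp (-(t * volume.real A)) * Real.exp (-(t * volume.real B)) := by
    rw [← Real.exp_add]; ring_nf
  rw [h2] at h1
  linear_combination -h1

/-- The cell of `x` in the cubical partition of mesh `1 / n`. -/
noncomputable def cell (n : ℕ) (x : EuclideanSpace ℝ (Fin d)) : Fin d → ℤ :=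
  fun i => ⌊(n : ℝ) * x i⌋

lemma measurable_cell (n : ℕ) : Measurable (cell (d := d) n) := by
  unfold cell
  fun_prop

lemma norm_sub_le_of_cell_eq {n : ℕ} (hn : 0 < n) {x y : EuclideanSpace ℝ (Fin d)}
    (h : cell n x = cell n y) : ‖x - y‖ ≤ √d / n := by
  have hn' : (0 : ℝ) < n := by exact_mod_cast hn
  rw [EuclideanSpace.norm_eq, le_div_iff₀ hn', ← Real.sqrt_sq hn'.le,
    ← Real.sqrt_mul (Finset.sum_nonneg fun i _ => sq_nonneg _)]
  refine Real.sqrt_le_sqrt ?_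
  rw [Finset.sum_mul]
  have : ∀ i ∈ Finset.univ, ‖(x - y) i‖ ^ 2 * (n : ℝ) ^ 2 ≤ 1 := by
    intro i _
    have h1 := congrFun h i
    have h2 := Int.abs_sub_lt_one_of_floor_eq_floor h1
    rw [← mul_sub, abs_mul, abs_of_pos hn'] at h2
    rw [← mul_pow, PiLp.sub_apply, Real.norm_eq_abs]
    have : 0 ≤ |x i - y i| * n := by positivity
    nlinarith
  simpa using Finset.sum_le_sum this

/-- Finitely many points end up in different cells once the mesh is fine enough. -/
lemma eventually_injOn_cell (s : Finset (EuclideanSpace ℝ (Fin d))) :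
    ∀ᶠ n : ℕ in atTop, Set.InjOn (cell (d := d) n) s := by
  have hlim : Tendsto (fun n : ℕ => √d / n) atTop (𝓝 0) :=
    tendsto_const_div_atTop_nhds_zero_nat _
  have h : ∀ x ∈ s, ∀ y ∈ s, ∀ᶠ n : ℕ in atTop, cell n x = cell n y → x = y := by
    intro x _ y _
    rcases eq_or_ne x y with rfl | hxy
    · simp
    · have hpos : 0 < ‖x - y‖ := norm_pos_iff.2 (sub_ne_zero.2 hxy)
      filter_upwards [hlim.eventually_lt_const hpos, eventually_gt_atTop 0] with n hn hn0 he
      exact absurd (norm_sub_le_of_cell_eq hn0 he) (not_le.2 hn)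
  have h2 := (s.eventually_all).2 fun x hx => (s.eventually_all).2 (h x hx)
  filter_upwards [h2] with n hn x hx y hy using hn x hx y hy

/-- Pairs of different cells, the first one containing a point of `s ∩ A` and the second one a
point of `s ∩ B`. -/
def hitPairs (n : ℕ) (s : Finset (EuclideanSpace ℝ (Fin d)))
    (A B : Set (EuclideanSpace ℝ (Fin d))) : Set ((Fin d → ℤ) × (Fin d → ℤ)) :=
  {p | p.1 ≠ p.2 ∧ ((s : Set (EuclideanSpace ℝ (Fin d))) ∩ (A ∩ cell n ⁻¹' {p.1})).ncard ≠ 0 ∧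
    ((s : Set (EuclideanSpace ℝ (Fin d))) ∩ (B ∩ cell n ⁻¹' {p.2})).ncard ≠ 0}

lemma mem_hitPairs {n : ℕ} {s : Finset (EuclideanSpace ℝ (Fin d))}
    {A B : Set (EuclideanSpace ℝ (Fin d))} {p : (Fin d → ℤ) × (Fin d → ℤ)} :
    p ∈ hitPairs n s A B ↔
      p.1 ≠ p.2 ∧ (∃ x ∈ s, x ∈ A ∧ cell n x = p.1) ∧ (∃ y ∈ s, y ∈ B ∧ cell n y = p.2) := by
  have : ∀ (C : Set (EuclideanSpace ℝ (Fin d))) i,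
      ((s : Set (EuclideanSpace ℝ (Fin d))) ∩ (C ∩ cell n ⁻¹' {i})).ncard ≠ 0 ↔
        ∃ x ∈ s, x ∈ C ∧ cell n x = i := by
    intro C i
    rw [ne_eq, Set.ncard_eq_zero (s.finite_toSet.inter_of_left _), ← ne_eq,
      ← Set.nonempty_iff_ne_empty]
    rfl
  rw [← this, ← this]
  rfl

lemma hitPairs_encard_le (n : ℕ) (s : Finset (EuclideanSpace ℝ (Fin d)))
    {A B : Set (EuclideanSpace ℝ (Fin d))} (hA : MeasurableSet A) (hB : MeasurableSet B) :
    ((hitPairs n s A B).encard : ℝ≥0∞) ≤ pairMeasure s (A ×ˢ B) := by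
  rw [pairMeasure_apply s (hA.prod hB)]
  norm_cast
  refine le_trans (Set.encard_le_encard ?_) (Set.encard_image_le (Prod.map (cell n) (cell n)) _)
  rintro ⟨i, j⟩ hp
  obtain ⟨hij, ⟨x, hx, hxA, rfl⟩, y, hy, hyB, rfl⟩ := mem_hitPairs.1 hp
  exact ⟨(x, y), ⟨⟨hx, hy, fun h => hij (congrArg (cell n) h)⟩, hxA, hyB⟩, rfl⟩

/-- Once the mesh separates the points of `s`, different pairs of points hit different pairs of
cells. -/
lemma eventually_le_hitPairs_encard (s : Finset (EuclideanSpace ℝ (Fin d)))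
    {A B : Set (EuclideanSpace ℝ (Fin d))} (hA : MeasurableSet A) (hB : MeasurableSet B) :
    ∀ᶠ n : ℕ in atTop, pairMeasure s (A ×ˢ B) ≤ ((hitPairs n s A B).encard : ℝ≥0∞) := by
  filter_upwards [eventually_injOn_cell s] with n hn
  rw [pairMeasure_apply s (hA.prod hB)]
  norm_cast
  have hinj : Set.InjOn (Prod.map (cell n) (cell n))
      ({p : EuclideanSpace ℝ (Fin d) × EuclideanSpace ℝ (Fin d) |
        p.1 ∈ s ∧ p.2 ∈ s ∧ p.1 ≠ p.2} ∩ A ×ˢ B) := by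
    rintro ⟨x, y⟩ ⟨⟨hx, hy, -⟩, -⟩ ⟨x', y'⟩ ⟨⟨hx', hy', -⟩, -⟩ h
    exact Prod.ext (hn hx hx' (Prod.ext_iff.1 h).1) (hn hy hy' (Prod.ext_iff.1 h).2)
  rw [← hinj.encard_image]
  refine Set.encard_le_encard ?_
  rintro _ ⟨⟨x, y⟩, ⟨⟨hx, hy, hxy⟩, hxA, hyB⟩, rfl⟩
  exact mem_hitPairs.2 ⟨fun h => hxy (hn hx hy h), ⟨x, hx, hxA, rfl⟩, y, hy, hyB, rfl⟩

open Classical in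
lemma hitPairs_encard_eq_tsum (n : ℕ) (s : Finset (EuclideanSpace ℝ (Fin d)))
    (A B : Set (EuclideanSpace ℝ (Fin d))) :
    ((hitPairs n s A B).encard : ℝ≥0∞) = ∑' p, if p ∈ hitPairs n s A B then 1 else 0 := by
  rw [← ENNReal.tsum_set_one, tsum_subtype (hitPairs n s A B) fun _ => (1 : ℝ≥0∞)]
  rfl

/-- The expected number of hit pairs of cells, from the void probabilities. -/
lemma IsPoissonProcess.lintegral_hitPairs (hη : IsPoissonProcess P W t η) (hWc : IsCompact W)
    (ht : 0 < t) (n : ℕ)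
    {A B : Set (EuclideanSpace ℝ (Fin d))} (hA : MeasurableSet A) (hB : MeasurableSet B)
    (hAW : A ⊆ W) (hBW : B ⊆ W) :
    (Measurable fun ω => ((hitPairs n (η ω).1 A B).encard : ℝ≥0∞)) ∧
    ∫⁻ ω, ((hitPairs n (η ω).1 A B).encard : ℝ≥0∞) ∂P =
      ∑' p : (Fin d → ℤ) × (Fin d → ℤ), if p.1 ≠ p.2 then
        ENNReal.ofReal (1 - Real.exp (-(t * volume.real (A ∩ cell n ⁻¹' {p.1})))) *
        ENNReal.ofReal (1 - Real.exp (-(t * volume.real (B ∩ cell n ⁻¹' {p.2})))) else 0 := by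
  classical
  have hWm := hWc.measurableSet
  have m : ∀ C : Set (EuclideanSpace ℝ (Fin d)), MeasurableSet C →
      MeasurableSet {ω | (η ω).count C ≠ 0} := fun C hC =>
    ((PointConfig.measurable_count hWm hC).comp hη.measurable) (measurableSet_singleton 0).compl
  have hcell : ∀ i, MeasurableSet (cell (d := d) n ⁻¹' {i}) := fun i =>
    measurable_cell n (measurableSet_singleton i)
  have key : ∀ p : (Fin d → ℤ) × (Fin d → ℤ), {ω | p ∈ hitPairs n (η ω).1 A B} =
      {ω | p.1 ≠ p.2} ∩ ({ω | (η ω).count (A ∩ cell n ⁻¹' {p.1}) ≠ 0} ∩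
        {ω | (η ω).count (B ∩ cell n ⁻¹' {p.2}) ≠ 0}) := fun p => rfl
  have hmeas : ∀ p : (Fin d → ℤ) × (Fin d → ℤ),
      MeasurableSet {ω | p ∈ hitPairs n (η ω).1 A B} := fun p => by
    rw [key]
    exact (MeasurableSet.const _).inter
      ((m _ (hA.inter (hcell _))).inter (m _ (hB.inter (hcell _))))
  have hmeas' : ∀ p : (Fin d → ℤ) × (Fin d → ℤ), Measurable fun ω =>
      (if p ∈ hitPairs n (η ω).1 A B then 1 else 0 : ℝ≥0∞) := fun p =>
    Measurable.ite (hmeas p) measurable_const measurable_const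
  simp_rw [hitPairs_encard_eq_tsum]
  refine ⟨Measurable.tsum hmeas', ?_⟩
  rw [lintegral_tsum fun p => (hmeas' p).aemeasurable]
  refine tsum_congr fun p => ?_
  have : (fun ω => (if p ∈ hitPairs n (η ω).1 A B then 1 else 0 : ℝ≥0∞)) =
      {ω | p ∈ hitPairs n (η ω).1 A B}.indicator 1 := by
    ext ω; simp [Set.indicator_apply]
  rw [this, lintegral_indicator_one (hmeas p), key]
  by_cases hp : p.1 = p.2
  · simp [hp]
  · have hdisj : Disjoint (A ∩ cell n ⁻¹' {p.1}) (B ∩ cell n ⁻¹' {p.2}) := by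
      rw [Set.disjoint_left]
      rintro x ⟨-, h1⟩ ⟨-, h2⟩
      exact hp (h1.symm.trans h2)
    have h := hη.hit_prob hWc (hA.inter (hcell p.1)) (hB.inter (hcell p.2))
      (Set.inter_subset_left.trans hAW) (Set.inter_subset_left.trans hBW) hdisj
    rw [if_pos hp, ← ENNReal.ofReal_mul, ← h]
    · simp only [ne_eq, hp, not_false_eq_true, Set.ofPred_true, Set.univ_inter]
      exact (ofReal_measureReal).symm
    · rw [sub_nonneg, Real.exp_le_one_iff]
      have := mul_nonneg ht.le (measureReal_nonneg (μ := volume) (s := A ∩ cell n ⁻¹' {p.1}))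
      linarith

lemma tsum_measure_inter_cell (n : ℕ) (A : Set (EuclideanSpace ℝ (Fin d)))
    (hA : MeasurableSet A) :
    ∑' i, volume (A ∩ cell n ⁻¹' {i}) = volume A := by
  rw [← measure_iUnion]
  · congr 1
    ext x
    simp
  · intro i j hij
    refine Set.disjoint_left.2 ?_
    rintro x ⟨-, h1⟩ ⟨-, h2⟩
    exact hij (h1.symm.trans h2)
  · exact fun i => hA.inter (measurable_cell n (measurableSet_singleton i))

/-- The volume of a cell is bounded by the volume of a ball of radius `√d / n`. -/
lemma volume_inter_cell_le {n : ℕ} (hn : 0 < n) (A : Set (EuclideanSpace ℝ (Fin d)))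
    (i : Fin d → ℤ) : volume (A ∩ cell n ⁻¹' {i}) ≤
      volume (Metric.closedBall (0 : EuclideanSpace ℝ (Fin d)) (√d / n)) := by
  refine (measure_mono Set.inter_subset_right).trans ?_
  rcases (cell (d := d) n ⁻¹' {i}).eq_empty_or_nonempty with h | ⟨x, hx⟩
  · simp [h]
  · rw [← Measure.addHaar_closedBall_center volume x]
    refine measure_mono fun y hy => ?_
    rw [mem_closedBall_iff_norm]
    exact norm_sub_le_of_cell_eq hn (hy.trans hx.symm)

lemma tendsto_volume_ball_mesh (hd : 1 ≤ d) :
    Tendsto (fun n : ℕ => volume (Metric.closedBall (0 : EuclideanSpace ℝ (Fin d)) (√d / n)))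
      atTop (𝓝 0) := by
  have : Nonempty (Fin d) := ⟨⟨0, hd⟩⟩
  have h1 := tendsto_measure_cthickening_of_isCompact (μ := volume)
    (isCompact_singleton (x := (0 : EuclideanSpace ℝ (Fin d))))
  rw [measure_singleton] at h1
  have h2 := h1.comp (tendsto_const_div_atTop_nhds_zero_nat (√d))
  refine h2.congr fun n => ?_
  simp only [Function.comp]
  rw [Metric.cthickening_singleton _ (by positivity)]

/-- The second factorial moment measure of a Poisson process, on rectangles. -/
lemma IsPoissonProcess.lintegral_pairMeasure_prod (hη : IsPoissonProcess P W t η)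
    (hWc : IsCompact W) (hd : 1 ≤ d) (ht : 0 < t)
    {A B : Set (EuclideanSpace ℝ (Fin d))} (hA : MeasurableSet A) (hB : MeasurableSet B)
    (hAW : A ⊆ W) (hBW : B ⊆ W) :
    ∫⁻ ω, pairMeasure (η ω).1 (A ×ˢ B) ∂P =
      ENNReal.ofReal t * volume A * (ENNReal.ofReal t * volume B) := by
  set τ := ENNReal.ofReal t with hτ
  have hfin : ∀ C ⊆ W, volume C ≠ ∞ := fun C hC =>
    ((measure_mono hC).trans_lt hWc.measure_lt_top).ne
  set a : ℕ → (Fin d → ℤ) → ℝ≥0∞ := fun n i => τ * volume (A ∩ cell n ⁻¹' {i}) with ha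
  set b : ℕ → (Fin d → ℤ) → ℝ≥0∞ := fun n i => τ * volume (B ∩ cell n ⁻¹' {i}) with hb
  set ε : ℕ → ℝ≥0∞ := fun n =>
    τ * volume (Metric.closedBall (0 : EuclideanSpace ℝ (Fin d)) (√d / n)) with hε
  have hεlim : Tendsto ε atTop (𝓝 0) := by
    have := ENNReal.Tendsto.const_mul (a := τ) (tendsto_volume_ball_mesh hd)
      (Or.inr ENNReal.ofReal_ne_top)
    rwa [mul_zero] at this
  have hsum : ∀ (n : ℕ), ∑' p : (Fin d → ℤ) × (Fin d → ℤ), a n p.1 * b n p.2 =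
      τ * volume A * (τ * volume B) := by
    intro n
    rw [ENNReal.tsum_prod (f := fun i j => a n i * b n j)]
    simp_rw [ENNReal.tsum_mul_left, ENNReal.tsum_mul_right, ha, hb, ENNReal.tsum_mul_left,
      tsum_measure_inter_cell n A hA, tsum_measure_inter_cell n B hB]
  have hofReal : ∀ C ⊆ W, ENNReal.ofReal (t * volume.real C) = τ * volume C := by
    intro C hC
    rw [ENNReal.ofReal_mul ht.le, ofReal_measureReal (hfin C hC)]
  have hup : ∀ C ⊆ W, ENNReal.ofReal (1 - Real.exp (-(t * volume.real C))) ≤ τ * volume C := by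
    intro C hC
    rw [← hofReal C hC]
    refine ENNReal.ofReal_le_ofReal ?_
    linarith [Real.add_one_le_exp (-(t * volume.real C))]
  have hlow : ∀ C ⊆ W, (1 - τ * volume C) * (τ * volume C) ≤
      ENNReal.ofReal (1 - Real.exp (-(t * volume.real C))) := by
    intro C hC
    rw [← hofReal C hC]
    set x := t * volume.real C
    have hx : 0 ≤ x := mul_nonneg ht.le measureReal_nonneg
    rw [← ENNReal.ofReal_one, ← ENNReal.ofReal_sub _ hx, ← ENNReal.ofReal_mul' hx]
    refine ENNReal.ofReal_le_ofReal ?_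
    have h1 : Real.exp (-x) * (1 + x) ≤ 1 := by
      have := Real.add_one_le_exp x
      calc Real.exp (-x) * (1 + x) ≤ Real.exp (-x) * Real.exp x := by
            gcongr; linarith
        _ = 1 := by rw [← Real.exp_add]; simp
    -- `exp (-x) ≤ 1 / (1 + x) ≤ 1 - x + x ^ 2`
    have h2 : Real.exp (-x) ≤ 1 - x + x ^ 2 := by
      by_contra h
      push Not at h
      nlinarith [pow_nonneg hx 3]
    nlinarith
  have hE : ∀ n, ∫⁻ ω, ((hitPairs n (η ω).1 A B).encard : ℝ≥0∞) ∂P ≤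
      τ * volume A * (τ * volume B) := by
    intro n
    rw [(hη.lintegral_hitPairs hWc ht n hA hB hAW hBW).2, ← hsum n]
    refine ENNReal.tsum_le_tsum fun p => ?_
    split_ifs
    · exact mul_le_mul' (hup _ (Set.inter_subset_left.trans hAW))
        (hup _ (Set.inter_subset_left.trans hBW))
    · exact zero_le
  refine le_antisymm ?_ ?_
  · calc ∫⁻ ω, pairMeasure (η ω).1 (A ×ˢ B) ∂P
        ≤ ∫⁻ ω, liminf (fun n => ((hitPairs n (η ω).1 A B).encard : ℝ≥0∞)) atTop ∂P :=
          lintegral_mono fun ω =>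
            le_liminf_of_le (by isBoundedDefault) (eventually_le_hitPairs_encard _ hA hB)
      _ ≤ liminf (fun n => ∫⁻ ω, ((hitPairs n (η ω).1 A B).encard : ℝ≥0∞) ∂P) atTop :=
          lintegral_liminf_le fun n => (hη.lintegral_hitPairs hWc ht n hA hB hAW hBW).1
      _ ≤ τ * volume A * (τ * volume B) :=
          (liminf_le_liminf (Eventually.of_forall hE)).trans (by simp)
  · set X := ∫⁻ ω, pairMeasure (η ω).1 (A ×ˢ B) ∂P with hX
    have hn : ∀ n : ℕ, 0 < n → (1 - ε n) * (1 - ε n) * (τ * volume A * (τ * volume B)) ≤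
        X + ε n * (τ * volume B) := by
      intro n hn
      have haε : ∀ i, a n i ≤ ε n := fun i => by
        simp only [ha, hε]; exact mul_le_mul_right (volume_inter_cell_le hn A i) _
      have hbε : ∀ i, b n i ≤ ε n := fun i => by
        simp only [hb, hε]; exact mul_le_mul_right (volume_inter_cell_le hn B i) _
      have h2 : ∑' p : (Fin d → ℤ) × (Fin d → ℤ), (if p.1 = p.2 then ε n * b n p.2 else 0) =
          ε n * (τ * volume B) := by
        have hdiag : ∀ i, ∑' j, (if i = j then ε n * b n j else 0) = ε n * b n i := fun i => by
          rw [tsum_eq_single i fun j hj => if_neg hj.symm, if_pos rfl]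
        rw [ENNReal.tsum_prod (f := fun i j => if i = j then ε n * b n j else 0)]
        simp_rw [hdiag, ENNReal.tsum_mul_left, hb, ENNReal.tsum_mul_left,
          tsum_measure_inter_cell n B hB]
      have h1 : ∫⁻ ω, ((hitPairs n (η ω).1 A B).encard : ℝ≥0∞) ∂P ≤ X :=
        lintegral_mono fun ω => hitPairs_encard_le n _ hA hB
      rw [(hη.lintegral_hitPairs hWc ht n hA hB hAW hBW).2] at h1
      refine le_trans ?_ (add_le_add h1 h2.le)
      rw [← ENNReal.tsum_add, ← hsum n, ← ENNReal.tsum_mul_left]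
      refine ENNReal.tsum_le_tsum fun p => ?_
      by_cases hp : p.1 = p.2
      · rw [if_neg (not_not.2 hp), if_pos hp, zero_add]
        calc (1 - ε n) * (1 - ε n) * (a n p.1 * b n p.2) ≤ 1 * 1 * (ε n * b n p.2) := by
              gcongr
              · exact tsub_le_self
              · exact tsub_le_self
              · exact haε _
          _ = ε n * b n p.2 := by simp
      · rw [if_pos hp, if_neg hp, add_zero]
        calc (1 - ε n) * (1 - ε n) * (a n p.1 * b n p.2)
            = ((1 - ε n) * a n p.1) * ((1 - ε n) * b n p.2) := by ring
          _ ≤ ((1 - a n p.1) * a n p.1) * ((1 - b n p.2) * b n p.2) := by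
              gcongr
              · exact haε _
              · exact hbε _
          _ ≤ _ := mul_le_mul' (hlow _ (Set.inter_subset_left.trans hAW))
              (hlow _ (Set.inter_subset_left.trans hBW))
    have hAfin : τ * volume A ≠ ∞ := ENNReal.mul_ne_top ENNReal.ofReal_ne_top (hfin A hAW)
    have hBfin : τ * volume B ≠ ∞ := ENNReal.mul_ne_top ENNReal.ofReal_ne_top (hfin B hBW)
    have l1 : Tendsto (fun n => (1 - ε n)) atTop (𝓝 1) := by
      have := ENNReal.Tendsto.sub (tendsto_const_nhds (x := (1 : ℝ≥0∞))) hεlim (Or.inl (by simp))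
      rwa [tsub_zero] at this
    have l2 : Tendsto (fun n => (1 - ε n) * (1 - ε n) * (τ * volume A * (τ * volume B))) atTop
        (𝓝 (τ * volume A * (τ * volume B))) := by
      have := ENNReal.Tendsto.mul_const (b := τ * volume A * (τ * volume B))
        (ENNReal.Tendsto.mul l1 (by simp) l1 (by simp)) (Or.inr (ENNReal.mul_ne_top hAfin hBfin))
      simpa using this
    have l3 : Tendsto (fun n => X + ε n * (τ * volume B)) atTop (𝓝 X) := by
      have := (ENNReal.Tendsto.mul_const hεlim (Or.inr hBfin)).const_add X
      simpa using this
    exact le_of_tendsto_of_tendsto l2 l3 ((eventually_gt_atTop 0).mono hn)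

/-- The second-order Campbell formula: the second factorial moment measure of a Poisson process of
intensity `t` has density `t ^ 2`. -/
lemma IsPoissonProcess.lintegral_sum_offDiag (hη : IsPoissonProcess P W t η)
    (hWc : IsCompact W) (hd : 1 ≤ d) (ht : 0 < t)
    {f : EuclideanSpace ℝ (Fin d) × EuclideanSpace ℝ (Fin d) → ℝ≥0∞} (hf : Measurable f) :
    ∫⁻ ω, ∫⁻ p, f p ∂(pairMeasure (η ω).1) ∂P =
      ENNReal.ofReal t ^ 2 *
        ∫⁻ p, f p ∂((volume.restrict W).prod (volume.restrict W)) := by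
  have hWm := hWc.measurableSet
  have hm : Measurable fun ω => pairMeasure (η ω).1 :=
    (measurable_pairMeasure hWm).comp hη.measurable
  rw [← Measure.lintegral_bind hm.aemeasurable hf.aemeasurable]
  have hfinW : IsFiniteMeasure (volume.restrict W) := ⟨by simpa using hWc.measure_lt_top⟩
  have hfin : IsFiniteMeasure (ENNReal.ofReal t • volume.restrict W) :=
    Measure.smul_finite _ ENNReal.ofReal_ne_top
  have key : P.bind (fun ω => pairMeasure (η ω).1) =
      (ENNReal.ofReal t • volume.restrict W).prod (ENNReal.ofReal t • volume.restrict W) := by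
    symm
    refine Measure.prod_eq fun A B hA hB => ?_
    rw [Measure.bind_apply (hA.prod hB) hm.aemeasurable]
    have h : ∀ ω, pairMeasure (η ω).1 (A ×ˢ B) = pairMeasure (η ω).1 ((A ∩ W) ×ˢ (B ∩ W)) := by
      intro ω
      rw [pairMeasure_prod _ hA hB, pairMeasure_prod _ (hA.inter hWm) (hB.inter hWm),
        ← Set.inter_inter_distrib_right]
      have h := fun C => PointConfig.count_inter (η ω) C
      simp only [PointConfig.count] at h
      rw [h, h, h]
    simp_rw [h]
    rw [hη.lintegral_pairMeasure_prod hWc hd ht (hA.inter hWm) (hB.inter hWm)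
      Set.inter_subset_right Set.inter_subset_right]
    simp [Measure.restrict_apply hA, Measure.restrict_apply hB]
  rw [key, Measure.prod_smul_left, Measure.prod_smul_right, smul_smul, lintegral_smul_measure, sq]
  rfl

end PoissonMoments

/-! ### Integrals of homogeneous functions against radial weights -/

section Polar

variable {E : Type*} [NormedAddCommGroup E] [NormedSpace ℝ E] [MeasurableSpace E] [BorelSpace E]
  [FiniteDimensional ℝ E] [Nontrivial E] (μ : Measure E) [μ.IsAddHaarMeasure]

/-- Polar coordinates for the product of a radial weight and a function which is homogeneous of
degree `k`: the integral factorizes into a radial part and an integral over the unit sphere. -/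
lemma lintegral_norm_mul_homogeneous (k : ℕ) {f : E → ℝ≥0∞} (hf : Measurable f)
    (hhom : ∀ (r : ℝ) (u : E), 0 < r → f (r • u) = ENNReal.ofReal (r ^ k) * f u)
    {w : ℝ → ℝ≥0∞} (hw : Measurable w) :
    ∫⁻ x, w ‖x‖ * f x ∂μ =
      (∫⁻ r in Set.Ioi (0 : ℝ), ENNReal.ofReal (r ^ (Module.finrank ℝ E - 1 + k)) * w r) *
        ∫⁻ u : Metric.sphere (0 : E) 1, f u ∂μ.toSphere := by
  have hmp := μ.measurePreserving_homeomorphUnitSphereProd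
  calc ∫⁻ x, w ‖x‖ * f x ∂μ
      = ∫⁻ x : ({(0)}ᶜ : Set E), w ‖x.1‖ * f x.1 ∂(μ.comap (↑)) := by
        rw [lintegral_subtype_comap (measurableSet_singleton _).compl fun x => w ‖x‖ * f x,
          restrict_compl_singleton]
    _ = ∫⁻ q : Metric.sphere (0 : E) 1 × Set.Ioi (0 : ℝ), f q.1.1 *
          (ENNReal.ofReal (q.2.1 ^ k) * w q.2.1)
          ∂μ.toSphere.prod (.volumeIoiPow (Module.finrank ℝ E - 1)) := by
        rw [← hmp.lintegral_comp_emb (Homeomorph.measurableEmbedding _)]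
        refine lintegral_congr fun x => ?_
        have hx : 0 < ‖x.1‖ := norm_pos_iff.2 x.2
        have h1 : f x.1 = ENNReal.ofReal (‖x.1‖ ^ k) * f (‖x.1‖⁻¹ • x.1) := by
          rw [← hhom _ _ hx, smul_smul, mul_inv_cancel₀ hx.ne', one_smul]
        simp only [homeomorphUnitSphereProd_apply_snd_coe, homeomorphUnitSphereProd_apply_fst_coe]
        rw [h1]
        ring
    _ = (∫⁻ u : Metric.sphere (0 : E) 1, f u ∂μ.toSphere) *
          ∫⁻ r : Set.Ioi (0 : ℝ), ENNReal.ofReal (r.1 ^ k) * w r.1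
            ∂.volumeIoiPow (Module.finrank ℝ E - 1) := by
        refine lintegral_prod_mul (f := fun u : Metric.sphere (0 : E) 1 => f u.1)
          (g := fun r : Set.Ioi (0 : ℝ) => ENNReal.ofReal (r.1 ^ k) * w r.1)
          (hf.comp measurable_subtype_coe).aemeasurable ?_
        exact ((ENNReal.measurable_ofReal.comp (measurable_subtype_coe.pow_const k)).mul
          (hw.comp measurable_subtype_coe)).aemeasurable
    _ = _ := by
        rw [mul_comm]
        congr 1
        rw [Measure.volumeIoiPow, lintegral_withDensity_eq_lintegral_mul₀]
        · rw [← lintegral_subtype_comap measurableSet_Ioi]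
          refine lintegral_congr fun r => ?_
          have hr : 0 ≤ r.1 := le_of_lt r.2
          simp only [Pi.mul_apply]
          rw [← mul_assoc, ← ENNReal.ofReal_mul (by positivity), ← pow_add]
        · exact (ENNReal.measurable_ofReal.comp
            (measurable_subtype_coe.pow_const _)).aemeasurable
        · exact ((ENNReal.measurable_ofReal.comp (measurable_subtype_coe.pow_const k)).mul
            (hw.comp measurable_subtype_coe)).aemeasurable

/-- The integral of `‖x‖ ^ α f x` over a ball, for `f` homogeneous of degree `k`. -/
lemma setLIntegral_closedBall_rpow_norm_mul_homogeneous (k : ℕ) {f : E → ℝ≥0∞} (hf : Measurable f)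
    (hhom : ∀ (r : ℝ) (u : E), 0 < r → f (r • u) = ENNReal.ofReal (r ^ k) * f u)
    {α R : ℝ} (hR : 0 ≤ R) (hα : 0 < α + Module.finrank ℝ E + k) :
    ∫⁻ x in Metric.closedBall (0 : E) R, ENNReal.ofReal (‖x‖ ^ α) * f x ∂μ =
      ENNReal.ofReal (R ^ (α + Module.finrank ℝ E + k) / (α + Module.finrank ℝ E + k)) *
        ∫⁻ u : Metric.sphere (0 : E) 1, f u ∂μ.toSphere := by
  have hdim : 0 < Module.finrank ℝ E := Module.finrank_pos
  have hw : Measurable ((Set.Iic R).indicator fun r : ℝ => ENNReal.ofReal (r ^ α)) :=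
    (by fun_prop : Measurable fun r : ℝ => ENNReal.ofReal (r ^ α)).indicator measurableSet_Iic
  have h := lintegral_norm_mul_homogeneous μ k hf hhom hw
  have h1 : ∫⁻ x in Metric.closedBall (0 : E) R, ENNReal.ofReal (‖x‖ ^ α) * f x ∂μ =
      ∫⁻ x, (Set.Iic R).indicator (fun r : ℝ => ENNReal.ofReal (r ^ α)) ‖x‖ * f x ∂μ := by
    rw [← lintegral_indicator measurableSet_closedBall]
    refine lintegral_congr fun x => ?_
    by_cases hx : ‖x‖ ≤ R <;> simp [hx]
  rw [h1, h]
  congr 1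
  set s := α + Module.finrank ℝ E + k with hs
  calc _ = ∫⁻ r in Set.Ioc (0 : ℝ) R, ENNReal.ofReal (r ^ (s - 1)) := by
        rw [← Set.Ioi_inter_Iic, Set.inter_comm, ← setLIntegral_indicator measurableSet_Iic]
        refine setLIntegral_congr_fun measurableSet_Ioi fun r hr => ?_
        have hr' : (0 : ℝ) < r := hr
        by_cases hrR : r ≤ R
        · simp only [Set.indicator_apply, Set.mem_Iic, hrR, if_true]
          rw [← ENNReal.ofReal_mul (by positivity), ← Real.rpow_natCast, ← Real.rpow_add hr']
          congr 2
          rw [hs, Nat.cast_add, Nat.cast_sub hdim]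
          push_cast
          ring
        · simp [hrR]
    _ = ENNReal.ofReal (R ^ s / s) := by
        rw [← ofReal_integral_eq_lintegral_ofReal
          ((intervalIntegral.intervalIntegrable_rpow' (by linarith)).1),
          ← intervalIntegral.integral_of_le hR, integral_rpow (Or.inl (by linarith))]
        · rw [sub_add_cancel, Real.zero_rpow hα.ne', sub_zero]
        · filter_upwards [ae_restrict_mem measurableSet_Ioc] with r hr
          exact Real.rpow_nonneg hr.1.le _

end Polar

lemma kappa_eq (j : ℕ) : kappa j = √Real.pi ^ j / Real.Gamma (j / 2 + 1) := by
  unfold kappa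
  rcases Nat.eq_zero_or_pos j with rfl | hj
  · have h1 : Metric.closedBall (0 : EuclideanSpace ℝ (Fin 0)) 1 = Set.univ := by
      ext x; simp [Subsingleton.elim x 0]
    have h2 := (EuclideanSpace.volume_preserving_symm_measurableEquiv_toLp (Fin 0)).measure_preimage
      MeasurableSet.univ.nullMeasurableSet
    rw [Set.preimage_univ] at h2
    rw [h1, measureReal_def, h2]
    simp [volume_pi]
  · have : Nonempty (Fin j) := ⟨⟨0, hj⟩⟩
    rw [measureReal_def, EuclideanSpace.volume_closedBall]
    have : 0 ≤ √Real.pi ^ j / Real.Gamma (j / 2 + 1) :=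
      div_nonneg (by positivity) (Real.Gamma_pos_of_pos (by positivity)).le
    simp [this]

lemma kappa_nonneg (j : ℕ) : 0 ≤ kappa j := measureReal_nonneg

/-- The positive part of a coordinate has Gaussian integral `√π ^ (d - 1) / 2`. -/
lemma lintegral_posPart_coord_mul_exp (i₀ : Fin d) :
    ∫⁻ x : EuclideanSpace ℝ (Fin d),
      ENNReal.ofReal (Real.exp (-‖x‖ ^ 2)) * ENNReal.ofReal (x i₀) =
      ENNReal.ofReal (√Real.pi ^ (d - 1) / 2) := by
  set g : Fin d → ℝ → ℝ := fun i x =>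
    if i = i₀ then max (x * Real.exp (-1 * x ^ 2)) 0 else Real.exp (-1 * x ^ 2) with hg
  have hgint : ∀ i, Integrable (g i) := by
    intro i
    by_cases hi : i = i₀
    · simp only [hg, hi, if_true]
      exact (integrable_mul_exp_neg_mul_sq one_pos).pos_part
    · simp only [hg, hi, if_false]
      exact integrable_exp_neg_mul_sq one_pos
  have hg0 : ∀ i x, 0 ≤ g i x := by
    intro i x
    simp only [hg]
    split_ifs <;> positivity
  have hval : ∀ i, ∫ x, g i x = if i = i₀ then 1 / 2 else √Real.pi := by
    intro i
    by_cases hi : i = i₀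
    · simp only [hg, hi, if_true]
      have h1 : (fun x : ℝ => max (x * Real.exp (-1 * x ^ 2)) 0) =
          (Set.Ioi (0 : ℝ)).indicator fun x => x ^ (1 : ℝ) * Real.exp (-x ^ (2 : ℝ)) := by
        ext x
        by_cases hx : 0 < x
        · rw [Set.indicator_of_mem (by exact hx), max_eq_left (by positivity)]
          simp
        · rw [Set.indicator_of_notMem (by exact hx), max_eq_right]
          exact mul_nonpos_of_nonpos_of_nonneg (not_lt.1 hx) (Real.exp_pos _).le
      rw [h1, integral_indicator measurableSet_Ioi,
        integral_rpow_mul_exp_neg_rpow two_pos (by norm_num)]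
      norm_num
    · simp only [hg, hi, if_false]
      rw [integral_gaussian]
      simp
  have h1 : ∫⁻ x : EuclideanSpace ℝ (Fin d),
      ENNReal.ofReal (Real.exp (-‖x‖ ^ 2)) * ENNReal.ofReal (x i₀) =
      ∫⁻ x : Fin d → ℝ, ENNReal.ofReal (∏ i, g i (x i)) := by
    rw [← (EuclideanSpace.volume_preserving_symm_measurableEquiv_toLp (Fin d)).lintegral_comp_emb
      (MeasurableEquiv.measurableEmbedding _)]
    refine lintegral_congr fun x => ?_
    have h2 : ∏ i, g i (x i) = Real.exp (-‖x‖ ^ 2) * max (x i₀) 0 := by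
      have h3 : ∀ i, g i (x i) = Real.exp (-1 * x i ^ 2) * if i = i₀ then max (x i) 0 else 1 := by
        intro i
        simp only [hg]
        split_ifs
        · rw [mul_max_of_nonneg _ _ (Real.exp_pos _).le, mul_zero, mul_comm]
        · rw [mul_one]
      rw [Finset.prod_congr rfl fun i _ => h3 i, Finset.prod_mul_distrib, ← Real.exp_sum,
        Finset.prod_ite_eq' Finset.univ i₀, if_pos (Finset.mem_univ _), EuclideanSpace.norm_eq,
        Real.sq_sqrt (Finset.sum_nonneg fun i _ => sq_nonneg _), ← Finset.mul_sum]
      simp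
    change _ = ENNReal.ofReal (∏ i, g i (x i))
    rw [h2, ENNReal.ofReal_mul (Real.exp_pos _).le]
    congr 1
    rw [ENNReal.ofReal_max]
    simp
  rw [h1, volume_pi, ← ofReal_integral_eq_lintegral_ofReal (Integrable.fintype_prod hgint)
    (Eventually.of_forall fun x => Finset.prod_nonneg fun i _ => hg0 i _)]
  rw [integral_fintype_prod_eq_prod, Finset.prod_congr rfl fun i _ => hval i]
  congr 1
  rw [Finset.prod_ite, Finset.filter_eq' Finset.univ i₀, if_pos (Finset.mem_univ _),
    Finset.prod_const, Finset.prod_const, Finset.filter_ne', Finset.card_erase_of_mem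
    (Finset.mem_univ _)]
  simp
  ring

/-- The constant in Cauchy's surface area formula: the positive part of a coordinate integrates over
the unit sphere to `κ_{d-1}`, the volume of the equatorial ball onto which the half sphere
projects. -/
lemma lintegral_sphere_posPart_coord (i₀ : Fin d) :
    ∫⁻ u : Metric.sphere (0 : EuclideanSpace ℝ (Fin d)) 1, ENNReal.ofReal (u.1 i₀)
      ∂(volume : Measure (EuclideanSpace ℝ (Fin d))).toSphere = ENNReal.ofReal (kappa (d - 1)) := by
  have hd : 1 ≤ d := i₀.pos
  have : Nonempty (Fin d) := ⟨i₀⟩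
  have h := lintegral_norm_mul_homogeneous (volume : Measure (EuclideanSpace ℝ (Fin d))) 1
    (f := fun x => ENNReal.ofReal (x i₀)) (by fun_prop)
    (fun r u hr => by simp [ENNReal.ofReal_mul hr.le])
    (w := fun r => ENNReal.ofReal (Real.exp (-r ^ 2))) (by fun_prop)
  rw [lintegral_posPart_coord_mul_exp i₀, finrank_euclideanSpace, Fintype.card_fin,
    Nat.sub_add_cancel hd] at h
  have hG : 0 < Real.Gamma ((d + 1) / 2) := Real.Gamma_pos_of_pos (by positivity)
  have hrad : ∫⁻ r in Set.Ioi (0 : ℝ), ENNReal.ofReal (r ^ d) * ENNReal.ofReal (Real.exp (-r ^ 2)) =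
      ENNReal.ofReal (Real.Gamma ((d + 1) / 2) / 2) := by
    have h1 := integral_rpow_mul_exp_neg_rpow (p := 2) (q := d) two_pos
      (by linarith [(Nat.cast_nonneg d : (0 : ℝ) ≤ d)])
    rw [show Real.Gamma ((d + 1) / 2) / 2 = 1 / 2 * Real.Gamma ((d + 1) / 2) by ring, ← h1,
      ofReal_integral_eq_lintegral_ofReal]
    · refine setLIntegral_congr_fun measurableSet_Ioi fun r hr => ?_
      have hr' : (0 : ℝ) < r := hr
      rw [← ENNReal.ofReal_mul (by positivity)]
      simp
    · by_contra hcon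
      rw [integral_undef hcon] at h1
      have : 0 < 1 / 2 * Real.Gamma ((d + 1) / 2) := by positivity
      exact this.ne h1
    · filter_upwards [ae_restrict_mem measurableSet_Ioi] with r hr
      have hr' : (0 : ℝ) < r := hr
      simp only [Pi.zero_apply]
      positivity
  rw [hrad] at h
  have hG2 : ENNReal.ofReal (Real.Gamma ((d + 1) / 2) / 2) ≠ 0 := by
    simpa using hG
  have hk : ENNReal.ofReal (√Real.pi ^ (d - 1) / 2) =
      ENNReal.ofReal (Real.Gamma ((d + 1) / 2) / 2) * ENNReal.ofReal (kappa (d - 1)) := by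
    rw [← ENNReal.ofReal_mul (by positivity), kappa_eq, Nat.cast_sub hd,
      show ((d : ℝ) - (1 : ℕ)) / 2 + 1 = (d + 1) / 2 by push_cast; ring]
    congr 1
    field_simp
  rw [hk] at h
  exact ((ENNReal.mul_right_inj hG2 ENNReal.ofReal_ne_top).1 h).symm

/-! ### Sweeping a convex body along a segment -/

section Sweep

variable {E : Type*} [NormedAddCommGroup E] [NormedSpace ℝ E]

/-- The set `K + [0, y]` swept out by `K` as it is translated along the segment from `0` to `y`. -/
def sweep (K : Set E) (y : E) : Set E := {x | ∃ k ∈ K, ∃ τ ∈ Set.Icc (0 : ℝ) 1, k + τ • y = x}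

lemma mem_sweep_smul {K : Set E} {y x : E} {a : ℝ} (ha : 0 ≤ a) :
    x ∈ sweep K (a • y) ↔ ∃ k ∈ K, ∃ τ ∈ Set.Icc (0 : ℝ) a, k + τ • y = x := by
  constructor
  · rintro ⟨k, hk, τ, hτ, rfl⟩
    exact ⟨k, hk, τ * a, ⟨mul_nonneg hτ.1 ha, mul_le_of_le_one_left ha hτ.2⟩, by rw [smul_smul]⟩
  · rintro ⟨k, hk, τ, hτ, rfl⟩
    rcases ha.eq_or_lt with rfl | ha'
    · obtain rfl : τ = 0 := le_antisymm hτ.2 hτ.1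
      exact ⟨k, hk, 0, by simp, by simp⟩
    · exact ⟨k, hk, τ / a, ⟨div_nonneg hτ.1 ha, div_le_one_of_le₀ hτ.2 ha⟩,
        by rw [smul_smul, div_mul_cancel₀ _ ha'.ne']⟩

lemma subset_sweep (K : Set E) (y : E) : K ⊆ sweep K y :=
  fun k hk => ⟨k, hk, 0, by simp, by simp⟩

lemma sweep_mono {K L : Set E} (h : K ⊆ L) (y : E) : sweep K y ⊆ sweep L y := by
  rintro x ⟨k, hk, τ, hτ, rfl⟩
  exact ⟨k, h hk, τ, hτ, rfl⟩

lemma _root_.Convex.mem_of_sub_smul_mem_of_add_smul_mem {K : Set E} (hK : Convex ℝ K) {y z : E}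
    {a b : ℝ} (ha : 0 ≤ a) (hb : 0 ≤ b) (h1 : z - a • y ∈ K) (h2 : z + b • y ∈ K) : z ∈ K := by
  rcases ha.eq_or_lt with rfl | ha'
  · simpa using h1
  have hab : 0 < a + b := by linarith
  have h := hK h1 h2 (a := b / (a + b)) (b := a / (a + b)) (by positivity) (by positivity)
    (by field_simp; ring)
  convert! h using 1
  match_scalars
  · field_simp
    ring
  · field_simp
    ring

/-- For convex `K` the part of `K + [0, (a + b) y]` outside `K` splits into the part swept out
between times `0` and `a` and a translate of the part swept out between times `0` and `b`. -/
lemma sweep_add_smul_diff {K : Set E} (hK : Convex ℝ K) (y : E) {a b : ℝ} (ha : 0 ≤ a)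
    (hb : 0 ≤ b) :
    sweep K ((a + b) • y) \ K =
      (sweep K (a • y) \ K) ∪ (a • y +ᵥ (sweep K (b • y) \ K)) := by
  ext x
  simp only [Set.mem_sdiff, Set.mem_union, mem_sweep_smul ha, mem_sweep_smul (add_nonneg ha hb),
    mem_sweep_smul hb, Set.mem_vadd_set, vadd_eq_add]
  constructor
  · rintro ⟨⟨k, hk, τ, hτ, rfl⟩, hx⟩
    by_cases h : ∃ k' ∈ K, ∃ τ' ∈ Set.Icc (0 : ℝ) a, k' + τ' • y = k + τ • y
    · exact Or.inl ⟨h, hx⟩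
    · right
      have hτa : a < τ := by
        by_contra hcon
        exact h ⟨k, hk, τ, ⟨hτ.1, not_lt.1 hcon⟩, rfl⟩
      refine ⟨k + (τ - a) • y, ⟨⟨k, hk, τ - a, ⟨by linarith, by linarith [hτ.2]⟩, rfl⟩, ?_⟩, ?_⟩
      · intro hz
        exact h ⟨_, hz, a, ⟨ha, le_rfl⟩, by module⟩
      · module
  · rintro (⟨⟨k, hk, τ, hτ, rfl⟩, hx⟩ | ⟨z, ⟨⟨k, hk, τ, hτ, rfl⟩, hz⟩, rfl⟩)
    · exact ⟨⟨k, hk, τ, ⟨hτ.1, by linarith [hτ.2]⟩, rfl⟩, hx⟩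
    · refine ⟨⟨k, hk, τ + a, ⟨by linarith [hτ.1], by linarith [hτ.2]⟩, by module⟩, fun hx => hz ?_⟩
      refine hK.mem_of_sub_smul_mem_of_add_smul_mem hτ.1 ha (y := y) ?_ ?_
      · convert! hk using 1; module
      · convert! hx using 1; module

lemma disjoint_sweep_diff {K : Set E} (hK : Convex ℝ K) (y : E) {a b : ℝ} (ha : 0 ≤ a)
    (hb : 0 ≤ b) :
    Disjoint (sweep K (a • y) \ K) (a • y +ᵥ (sweep K (b • y) \ K)) := by
  rw [Set.disjoint_left]
  rintro x ⟨hx, -⟩ ⟨z, ⟨hz, hzK⟩, rfl⟩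
  obtain ⟨k, hk, τ, hτ, hkx⟩ := (mem_sweep_smul ha).1 hx
  obtain ⟨k', hk', σ, hσ, rfl⟩ := (mem_sweep_smul hb).1 hz
  simp only [vadd_eq_add] at hkx
  refine hzK (hK.mem_of_sub_smul_mem_of_add_smul_mem hσ.1 (b := a - τ) (by linarith [hτ.2])
    (y := y) ?_ ?_)
  · convert! hk' using 1; module
  · convert! hk using 1
    rw [eq_sub_of_add_eq hkx]
    module

/-- The graph of the sweep is a projection of a closed set along the compact interval `[0, 1]`. -/
lemma isClosed_sweep_graph {K : Set E} (hK : IsClosed K) (c : ℝ) :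
    IsClosed {q : E × E | q.2 ∈ sweep K (c • q.1)} := by
  have h : IsClosed {q : Set.Icc (0 : ℝ) 1 × (E × E) | q.2.2 - q.1.1 • c • q.2.1 ∈ K} :=
    hK.preimage (by fun_prop)
  convert! isClosedMap_snd_of_compactSpace _ h using 1
  ext ⟨y, x⟩
  constructor
  · rintro ⟨k, hk, τ, hτ, hx⟩
    obtain rfl : k + τ • c • y = x := hx
    exact ⟨(⟨τ, hτ⟩, y, k + τ • c • y), by simpa using hk, rfl⟩
  · rintro ⟨⟨⟨τ, hτ⟩, y', x'⟩, h1, h2⟩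
    obtain ⟨rfl, rfl⟩ := Prod.ext_iff.1 h2
    exact ⟨_, h1, τ, hτ, by simp⟩

lemma isCompact_sweep {K : Set E} (hK : IsCompact K) (y : E) : IsCompact (sweep K y) := by
  have h : sweep K y = (fun p : E × ℝ => p.1 + p.2 • y) '' (K ×ˢ Set.Icc (0 : ℝ) 1) := by
    ext x
    simp [sweep, and_assoc]
  rw [h]
  exact (hK.prod isCompact_Icc).image (by fun_prop)

end Sweep

/-- A nonnegative function which is additive on the half line is linear. -/
lemma eq_mul_of_additive_nonneg {f : ℝ → ℝ} (hadd : ∀ a b, 0 ≤ a → 0 ≤ b → f (a + b) = f a + f b)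
    (hnn : ∀ a, 0 ≤ a → 0 ≤ f a) {a : ℝ} (ha : 0 ≤ a) : f a = a * f 1 := by
  have hmono : ∀ a b, 0 ≤ a → a ≤ b → f a ≤ f b := by
    intro a b ha hab
    have := hadd a (b - a) ha (by linarith)
    rw [add_sub_cancel] at this
    linarith [hnn (b - a) (by linarith)]
  have hnat : ∀ (n : ℕ) (a : ℝ), 0 ≤ a → f (n * a) = n * f a := by
    intro n a ha
    induction n with
    | zero =>
      have := hadd 0 0 le_rfl le_rfl
      simp only [add_zero] at this
      simp only [Nat.cast_zero, zero_mul]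
      linarith
    | succ n ih =>
      rw [Nat.cast_add, Nat.cast_one, add_mul, one_mul, hadd _ _ (by positivity) ha, ih]
      ring
  have hbound : ∀ n : ℕ, |n * (f a - a * f 1)| ≤ f 1 := by
    intro n
    have hna : 0 ≤ n * a := by positivity
    have h1 : f ⌊(n : ℝ) * a⌋₊ = ⌊(n : ℝ) * a⌋₊ * f 1 := by
      simpa using hnat ⌊(n : ℝ) * a⌋₊ 1 zero_le_one
    have h2 : f ((⌊(n : ℝ) * a⌋₊ + 1 : ℕ) : ℝ) = (⌊(n : ℝ) * a⌋₊ + 1 : ℕ) * f 1 := by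
      simpa using hnat (⌊(n : ℝ) * a⌋₊ + 1) 1 zero_le_one
    have h3 := Nat.floor_le hna
    have h4 := Nat.lt_floor_add_one ((n : ℝ) * a)
    -- monotonicity at the two integers around `n * a` determines `f a` up to an error `f 1 / n`
    have h5 := hmono _ _ (Nat.cast_nonneg _) h3
    have h6 := hmono (n * a) ((⌊(n : ℝ) * a⌋₊ + 1 : ℕ) : ℝ) hna (by push_cast; exact h4.le)
    rw [hnat n a ha] at h5 h6
    rw [h1] at h5
    rw [h2] at h6
    push_cast at h6
    have h7 := hnn 1 zero_le_one
    rw [abs_le]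
    constructor <;> nlinarith
  by_contra hne
  have hpos : 0 < |f a - a * f 1| := abs_pos.2 (sub_ne_zero.2 hne)
  obtain ⟨n, hn⟩ := exists_nat_gt (f 1 / |f a - a * f 1|)
  rw [div_lt_iff₀ hpos] at hn
  have := hbound n
  rw [abs_mul, Nat.abs_cast] at this
  linarith

/-- A point outside of `K` that lies on `K + [0, y]` sees `y` at a small angle to the outer normal
of `K` at its nearest point. -/
lemma exists_unit_infDist_le_inner {E : Type*} [NormedAddCommGroup E] [InnerProductSpace ℝ E]
    {K : Set E} (hKc : IsCompact K) (hK : Convex ℝ K)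
    (hne : K.Nonempty) {x : E} (hx : x ∉ K) :
    ∃ n : E, ‖n‖ = 1 ∧ ∀ y, x ∈ sweep K y → Metric.infDist x K ≤ inner ℝ y n := by
  obtain ⟨p, hp, hpd⟩ := hKc.exists_infDist_eq_dist hne x
  have hpos : 0 < ‖x - p‖ := norm_pos_iff.2 (sub_ne_zero.2 fun h => hx (h ▸ hp))
  have hproj : ∀ w ∈ K, inner ℝ (x - p) (w - p) ≤ 0 := by
    rw [← norm_eq_iInf_iff_real_inner_le_zero hK hp, ← dist_eq_norm, ← hpd,
      Metric.infDist_eq_iInf]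
    simp_rw [dist_eq_norm]
  refine ⟨‖x - p‖⁻¹ • (x - p), by rw [norm_smul, norm_inv, norm_norm, inv_mul_cancel₀ hpos.ne'], ?_⟩
  rintro y ⟨k, hk, τ, hτ, hkx⟩
  have h1 := hproj k hk
  have h2 : x - p = (k - p) + τ • y := by rw [← hkx]; abel
  have h3 : ‖x - p‖ ^ 2 = inner ℝ (x - p) (k - p) + τ * inner ℝ (x - p) y := by
    rw [← real_inner_self_eq_norm_sq]
    conv_lhs => rw [h2]
    rw [← h2]
    nth_rewrite 2 [h2]
    rw [inner_add_right, inner_smul_right]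
  rw [hpd, dist_eq_norm, inner_smul_right, real_inner_comm, inv_mul_eq_div, le_div_iff₀ hpos]
  have h4 : ‖x - p‖ * ‖x - p‖ ≤ τ * inner ℝ (x - p) y := by nlinarith
  have h5 : 0 < τ * inner ℝ (x - p) y := by nlinarith [mul_pos hpos hpos]
  have h6 : 0 ≤ inner ℝ (x - p) y := by
    by_contra hcon
    nlinarith [mul_nonneg hτ.1 (neg_nonneg.2 (not_le.1 hcon).le)]
  nlinarith [hτ.2]

section Shade

variable {E : Type*} [NormedAddCommGroup E] [InnerProductSpace ℝ E] [FiniteDimensional ℝ E]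
  [MeasurableSpace E] [BorelSpace E]

/-- The volume swept out by `K` outside of itself under translation along `[0, y]`. For a convex
body this is `‖y‖` times the volume of the projection of `K` onto the hyperplane orthogonal to
`y`. -/
noncomputable def shade (K : Set E) (y : E) : ℝ := volume.real (sweep K y \ K)

lemma shade_nonneg (K : Set E) (y : E) : 0 ≤ shade K y := measureReal_nonneg

lemma volume_sweep_diff_ne_top {K : Set E} (hKc : IsCompact K) (y : E) :
    volume (sweep K y \ K) ≠ ∞ :=
  ((measure_mono Set.sdiff_subset).trans_lt (isCompact_sweep hKc y).measure_lt_top).ne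

lemma ofReal_shade {K : Set E} (hKc : IsCompact K) (y : E) :
    ENNReal.ofReal (shade K y) = volume (sweep K y \ K) :=
  ofReal_measureReal (volume_sweep_diff_ne_top hKc y)

lemma shade_smul {K : Set E} (hKc : IsCompact K) (hK : Convex ℝ K) (y : E) {a : ℝ} (ha : 0 ≤ a) :
    shade K (a • y) = a * shade K y := by
  have h := eq_mul_of_additive_nonneg (f := fun a => shade K (a • y)) ?_
    (fun _ _ => shade_nonneg _ _) ha
  · simpa using h
  · intro a b ha hb
    have hm : MeasurableSet (a • y +ᵥ (sweep K (b • y) \ K)) :=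
      ((isCompact_sweep hKc _).measurableSet.diff hKc.measurableSet).const_vadd _
    simp only [shade]
    rw [sweep_add_smul_diff hK y ha hb,
      measureReal_union (disjoint_sweep_diff hK y ha hb) hm (volume_sweep_diff_ne_top hKc _)
        (by rw [measure_vadd]; exact volume_sweep_diff_ne_top hKc _)]
    simp [measureReal_def]

/-- Projections of convex bodies are monotone under inclusion: compare the volumes of the long
cylinders `K + [0, n y]` as `n → ∞`. -/
lemma shade_mono {K L : Set E} (hKc : IsCompact K) (hK : Convex ℝ K) (hLc : IsCompact L)
    (hL : Convex ℝ L) (hKL : K ⊆ L) (y : E) : shade K y ≤ shade L y := by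
  have key : ∀ {K : Set E}, IsCompact K → Convex ℝ K → ∀ n : ℕ,
      volume.real (sweep K ((n : ℝ) • y)) = n * shade K y + volume.real K := by
    intro K hKc hK n
    rw [← shade_smul hKc hK y n.cast_nonneg, shade,
      measureReal_sdiff (subset_sweep K _) hKc.measurableSet
        (isCompact_sweep hKc _).measure_lt_top.ne]
    ring
  by_contra hcon
  have hpos : 0 < shade K y - shade L y := by linarith [not_le.1 hcon]
  obtain ⟨n, hn⟩ := exists_nat_gt (volume.real L / (shade K y - shade L y))
  rw [div_lt_iff₀ hpos] at hn
  have h : volume.real (sweep K ((n : ℝ) • y)) ≤ volume.real (sweep L ((n : ℝ) • y)) :=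
    measureReal_mono (sweep_mono hKL _) (isCompact_sweep hLc _).measure_lt_top.ne
  rw [key hKc hK, key hLc hL] at h
  have : 0 ≤ volume.real K := measureReal_nonneg
  linarith

lemma measurable_volume_sweep_diff {K : Set E} (hK : IsClosed K) (c : ℝ) :
    Measurable fun y => volume (sweep K (c • y) \ K) := by
  have hm : MeasurableSet ({q : E × E | q.2 ∈ sweep K (c • q.1)} \ (Prod.snd ⁻¹' K)) :=
    (isClosed_sweep_graph hK c).measurableSet.diff (measurable_snd hK.measurableSet)
  exact measurable_measure_prodMk_left hm

lemma measurable_shade {K : Set E} (hK : IsClosed K) : Measurable (shade K) := by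
  have := (measurable_volume_sweep_diff hK 1).ennreal_toReal
  simp only [one_smul] at this
  exact this

end Shade

/-! ### Projections of a convex body and the volume of its parallel bodies -/

section Cauchy

variable {E : Type*} [NormedAddCommGroup E] [InnerProductSpace ℝ E] [FiniteDimensional ℝ E]
  [MeasurableSpace E] [BorelSpace E]

/-- Rotation invariance: the volume of a cap of the unit ball does not depend on its axis. -/
lemma volume_closedBall_inter_le_inner_eq {n e : E} (h : ‖n‖ = ‖e‖) (s ε : ℝ) :
    volume ({y : E | s ≤ ε * inner ℝ y n} ∩ Metric.closedBall 0 1) =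
      volume ({y : E | s ≤ ε * inner ℝ y e} ∩ Metric.closedBall 0 1) := by
  set ρ := (ℝ ∙ (n - e))ᗮ.reflection
  have hρ : ρ n = e := Submodule.reflection_sub h
  have hm : MeasurableSet ({y : E | s ≤ ε * inner ℝ y e} ∩ Metric.closedBall 0 1) :=
    (measurableSet_le measurable_const (by fun_prop)).inter measurableSet_closedBall
  rw [← ρ.measurePreserving.measure_preimage hm.nullMeasurableSet]
  congr 1
  ext y
  simp only [Set.mem_inter_iff, Set.mem_ofPred_eq, mem_closedBall_zero_iff, Set.mem_preimage]
  rw [ρ.norm_map, ← hρ, ρ.inner_map_map]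

/-- The volumes swept out by `K` along `[0, ε y]`, averaged over directions `y` in the unit ball,
are bounded by the volumes of parallel shells: a point at distance `s` from `K` is swept over only
by those `y` with `s ≤ ε ⟪y, n⟫` for an outer unit normal `n`, and by rotation invariance the
volume of this cap does not depend on `n`. -/
lemma lintegral_sweep_diff_le {K : Set E} (hKc : IsCompact K) (hK : Convex ℝ K)
    (hne : K.Nonempty) {e : E} (he : ‖e‖ = 1) (ε : ℝ) :
    ∫⁻ y in Metric.closedBall (0 : E) 1, volume (sweep K (ε • y) \ K) ≤
      ∫⁻ y in Metric.closedBall (0 : E) 1,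
        volume (Metric.cthickening (ε * inner ℝ y e) K \ K) := by
  have hKm := hKc.measurableSet
  set ν := (volume : Measure E).restrict (Metric.closedBall (0 : E) 1) with hν
  set S : Set (E × E) := {q | q.2 ∈ sweep K (ε • q.1)} \ (Prod.snd ⁻¹' K) with hS
  have hSm : MeasurableSet S :=
    (isClosed_sweep_graph hKc.isClosed ε).measurableSet.diff (measurable_snd hKm)
  set S' : Set (E × E) := {q | Metric.infDist q.2 K ≤ ε * inner ℝ q.1 e} \ (Prod.snd ⁻¹' K) with hS'
  have hdist : Continuous fun q : E × E => Metric.infDist q.2 K :=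
    (Metric.continuous_infDist_pt K).comp continuous_snd
  have hSm' : MeasurableSet S' :=
    (isClosed_le hdist (by fun_prop)).measurableSet.diff (measurable_snd hKm)
  calc ∫⁻ y, volume (sweep K (ε • y) \ K) ∂ν = (ν.prod volume) S := by
        rw [Measure.prod_apply hSm]; rfl
    _ = ∫⁻ x, ν ((fun y => (y, x)) ⁻¹' S) := Measure.prod_apply_symm hSm
    _ ≤ ∫⁻ x, ν ((fun y => (y, x)) ⁻¹' S') := by
        refine lintegral_mono fun x => ?_
        by_cases hx : x ∈ K
        · have : (fun y => (y, x)) ⁻¹' S = ∅ := by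
            ext y; simp [hS, hx]
          simp [this]
        · obtain ⟨n, hn, hsw⟩ := exists_unit_infDist_le_inner hKc hK hne hx
          have e1 : (fun y => (y, x)) ⁻¹' S ⊆ {y | Metric.infDist x K ≤ ε * inner ℝ y n} := by
            rintro y ⟨hy, -⟩
            have := hsw _ hy
            rwa [inner_smul_left] at this
          have e2 : (fun y => (y, x)) ⁻¹' S' = {y | Metric.infDist x K ≤ ε * inner ℝ y e} := by
            ext y; simp [hS', hx]
          refine (measure_mono e1).trans ?_
          rw [e2, hν, Measure.restrict_apply (measurableSet_le measurable_const (by fun_prop)),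
            Measure.restrict_apply (measurableSet_le measurable_const (by fun_prop)),
            volume_closedBall_inter_le_inner_eq (hn.trans he.symm)]
    _ = (ν.prod volume) S' := (Measure.prod_apply_symm hSm').symm
    _ = ∫⁻ y, volume (Prod.mk y ⁻¹' S') ∂ν := Measure.prod_apply hSm'
    _ ≤ ∫⁻ y, volume (Metric.cthickening (ε * inner ℝ y e) K \ K) ∂ν := by
        refine lintegral_mono fun y => measure_mono ?_
        rintro x ⟨hx, hxK⟩
        refine ⟨?_, hxK⟩
        obtain ⟨p, hp, hpd⟩ := hKc.exists_infDist_eq_dist hne x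
        exact Metric.mem_cthickening_of_dist_le x p _ K hp (hpd ▸ hx)

/-- The volume of the parallel body of `W` at distance `s`. -/
noncomputable def parallelVolume (W : Set E) (s : ℝ) : ℝ := volume.real (Metric.cthickening s W)

lemma parallelVolume_zero {W : Set E} (hW : IsCompact W) : parallelVolume W 0 = volume.real W := by
  rw [parallelVolume, Metric.cthickening_zero, hW.isClosed.closure_eq]

lemma monotone_parallelVolume {W : Set E} (hW : IsCompact W) : Monotone (parallelVolume W) :=
  fun _ _ h => measureReal_mono (Metric.cthickening_mono h W) hW.cthickening.measure_lt_top.ne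

lemma volume_cthickening_cthickening_diff_le {W : Set E} (hW : IsCompact W) {s : ℝ} (hs : 0 ≤ s)
    (h : ℝ) : volume (Metric.cthickening h (Metric.cthickening s W) \ Metric.cthickening s W) ≤
      ENNReal.ofReal (parallelVolume W (s + max h 0) - parallelVolume W s) := by
  have h1 : Metric.cthickening h (Metric.cthickening s W) ⊆ Metric.cthickening (s + max h 0) W := by
    rw [← Metric.cthickening_max_zero, max_comm 0, add_comm]
    exact Metric.cthickening_cthickening_subset (le_max_right _ _) hs W
  refine (measure_mono (Set.sdiff_subset_sdiff_left h1)).trans ?_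
  have h2 : Metric.cthickening s W ⊆ Metric.cthickening (s + max h 0) W :=
    Metric.cthickening_mono (by linarith [le_max_right h 0]) W
  have hfin : volume (Metric.cthickening (s + max h 0) W) ≠ ∞ := hW.cthickening.measure_lt_top.ne
  rw [parallelVolume, parallelVolume, ← measureReal_sdiff h2
    hW.cthickening.measurableSet hfin, ofReal_measureReal
    ((measure_mono Set.sdiff_subset).trans_lt hfin.lt_top).ne]

/-- A telescoping estimate: the increments of a monotone function, integrated over an interval. -/
lemma _root_.Monotone.intervalIntegral_add_sub_le {v : ℝ → ℝ} (hv : Monotone v) {T a : ℝ}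
    (ha : 0 ≤ a) :
    ∫ s in (0 : ℝ)..T, (v (s + a) - v s) ≤ a * (v (T + a) - v 0) := by
  have hi : ∀ x y, IntervalIntegrable v volume x y := fun x y => hv.intervalIntegrable
  have hi' : IntervalIntegrable (fun s => v (s + a)) volume 0 T :=
    Monotone.intervalIntegrable fun x y hxy => hv (by linarith)
  rw [intervalIntegral.integral_sub hi' (hi _ _), intervalIntegral.integral_comp_add_right]
  have h1 := intervalIntegral.integral_add_adjacent_intervals (hi 0 T) (hi T (T + a))
  have h2 := intervalIntegral.integral_add_adjacent_intervals (hi 0 a) (hi a (T + a))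
  have h3 : ∫ s in T..(T + a), v s ≤ a * v (T + a) := by
    have := intervalIntegral.integral_mono_on (by linarith) (hi T (T + a))
      (intervalIntegrable_const (c := v (T + a))) fun x hx => hv hx.2
    simpa using this
  have h4 : a * v 0 ≤ ∫ s in (0 : ℝ)..a, v s := by
    have := intervalIntegral.integral_mono_on ha
      (intervalIntegrable_const (c := v 0)) (hi 0 a) fun x hx => hv hx.1
    simpa using this
  rw [zero_add]
  linarith

lemma _root_.Monotone.setLIntegral_add_sub_le {v : ℝ → ℝ} (hv : Monotone v) {T a : ℝ}
    (hT : 0 ≤ T) (ha : 0 ≤ a) :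
    ∫⁻ s in Set.Ioc 0 T, ENNReal.ofReal (v (s + a) - v s) ≤
      ENNReal.ofReal (a * (v (T + a) - v 0)) := by
  have hi' : IntervalIntegrable (fun s => v (s + a)) volume 0 T :=
    Monotone.intervalIntegrable fun x y hxy => hv (by linarith)
  rw [← ofReal_integral_eq_lintegral_ofReal (hi'.sub hv.intervalIntegrable).1
    (Eventually.of_forall fun s => sub_nonneg.2 (hv (by linarith))),
    ← intervalIntegral.integral_of_le hT]
  exact ENNReal.ofReal_le_ofReal (hv.intervalIntegral_add_sub_le ha)

/-- The projection inequality behind Cauchy's surface area formula: apply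
`lintegral_sweep_diff_le` to all parallel bodies at distances in `[0, T]`, whose projections
dominate those of `W`. -/
lemma lintegral_shade_le_parallelVolume_add {W : Set E} (hWc : IsCompact W) (hW : Convex ℝ W)
    (hne : W.Nonempty) {e : E} (he : ‖e‖ = 1) {T ε : ℝ} (hT : 0 < T) (hε : 0 < ε) :
    ENNReal.ofReal T * ∫⁻ y in Metric.closedBall (0 : E) 1, ENNReal.ofReal (shade W y) ≤
      ENNReal.ofReal (parallelVolume W (T + ε) - parallelVolume W 0) *
        ∫⁻ y in Metric.closedBall (0 : E) 1, ENNReal.ofReal (inner ℝ y e) := by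
  have hv := monotone_parallelVolume hWc
  set v := parallelVolume W with hvdef
  set c := ∫⁻ y in Metric.closedBall (0 : E) 1, ENNReal.ofReal (shade W y) with hc
  have hstep : ∀ s ∈ Set.Ioc 0 T, ENNReal.ofReal ε * c ≤
      ∫⁻ y in Metric.closedBall (0 : E) 1,
        ENNReal.ofReal (v (s + max (ε * inner ℝ y e) 0) - v s) := by
    intro s hs
    have hsW := hWc.cthickening (r := s)
    calc ENNReal.ofReal ε * c
        = ∫⁻ y in Metric.closedBall (0 : E) 1, ENNReal.ofReal ε * ENNReal.ofReal (shade W y) := by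
          rw [lintegral_const_mul _ (measurable_shade hWc.isClosed).ennreal_ofReal]
      _ ≤ ∫⁻ y in Metric.closedBall (0 : E) 1,
            volume (sweep (Metric.cthickening s W) (ε • y) \ Metric.cthickening s W) := by
          refine lintegral_mono fun y => ?_
          rw [← ofReal_shade hsW, shade_smul hsW (hW.cthickening s) y hε.le,
            ENNReal.ofReal_mul hε.le]
          gcongr
          exact shade_mono hWc hW hsW (hW.cthickening s) (Metric.self_subset_cthickening W) y
      _ ≤ _ := lintegral_sweep_diff_le hsW (hW.cthickening s)
            (hne.mono (Metric.self_subset_cthickening W)) he ε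
      _ ≤ _ := lintegral_mono fun y => volume_cthickening_cthickening_diff_le hWc hs.1.le _
  have hmeas : Measurable fun q : ℝ × E =>
      ENNReal.ofReal (v (q.1 + max (ε * inner ℝ q.2 e) 0) - v q.1) :=
    ((hv.measurable.comp (by fun_prop)).sub (hv.measurable.comp measurable_fst)).ennreal_ofReal
  have hint : ENNReal.ofReal T * (ENNReal.ofReal ε * c) ≤
      ENNReal.ofReal (ε * (v (T + ε) - v 0)) *
        ∫⁻ y in Metric.closedBall (0 : E) 1, ENNReal.ofReal (inner ℝ y e) := by
    calc ENNReal.ofReal T * (ENNReal.ofReal ε * c)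
        = ∫⁻ _ in Set.Ioc 0 T, ENNReal.ofReal ε * c := by
          rw [setLIntegral_const, Real.volume_Ioc, sub_zero, mul_comm]
      _ ≤ ∫⁻ s in Set.Ioc 0 T, ∫⁻ y in Metric.closedBall (0 : E) 1,
            ENNReal.ofReal (v (s + max (ε * inner ℝ y e) 0) - v s) :=
          setLIntegral_mono' measurableSet_Ioc hstep
      _ = ∫⁻ y in Metric.closedBall (0 : E) 1, ∫⁻ s in Set.Ioc 0 T,
            ENNReal.ofReal (v (s + max (ε * inner ℝ y e) 0) - v s) :=
          lintegral_lintegral_swap hmeas.aemeasurable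
      _ ≤ ∫⁻ y in Metric.closedBall (0 : E) 1,
            ENNReal.ofReal (ε * (v (T + ε) - v 0)) * ENNReal.ofReal (inner ℝ y e) := by
          refine setLIntegral_mono' measurableSet_closedBall fun y hy => ?_
          refine (hv.setLIntegral_add_sub_le hT.le (le_max_right _ _)).trans ?_
          have hΔ : 0 ≤ v (T + ε) - v 0 := sub_nonneg.2 (hv (by linarith))
          rw [← ENNReal.ofReal_mul (by positivity)]
          have hy1 : inner ℝ y e ≤ 1 := by
            refine (real_inner_le_norm y e).trans ?_
            rw [he, mul_one]
            exact mem_closedBall_zero_iff.1 hy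
          rcases le_total (inner ℝ y e) 0 with h | h
          · rw [max_eq_right (mul_nonpos_of_nonneg_of_nonpos hε.le h)]
            simp
          · rw [max_eq_left (by positivity)]
            refine ENNReal.ofReal_le_ofReal ?_
            have : v (T + ε * inner ℝ y e) ≤ v (T + ε) := hv (by nlinarith)
            have h0 : 0 ≤ ε * inner ℝ y e := by positivity
            nlinarith
      _ = _ := by
          rw [lintegral_const_mul _ (by fun_prop)]
  rw [ENNReal.ofReal_mul hε.le, mul_left_comm, mul_assoc] at hint
  exact (ENNReal.mul_le_mul_iff_right (by simpa using hε) ENNReal.ofReal_ne_top).1 hint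

/-- The limit `ε → 0` of `lintegral_shade_le_parallelVolume_add`, by right continuity of the volume
of parallel bodies. -/
lemma lintegral_shade_le_parallelVolume {W : Set E} (hWc : IsCompact W) (hW : Convex ℝ W)
    (hne : W.Nonempty) {e : E} (he : ‖e‖ = 1) {T : ℝ} (hT : 0 < T) :
    ENNReal.ofReal T * ∫⁻ y in Metric.closedBall (0 : E) 1, ENNReal.ofReal (shade W y) ≤
      ENNReal.ofReal (parallelVolume W T - parallelVolume W 0) *
        ∫⁻ y in Metric.closedBall (0 : E) 1, ENNReal.ofReal (inner ℝ y e) := by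
  have hfin : ∫⁻ y in Metric.closedBall (0 : E) 1, ENNReal.ofReal (inner ℝ y e) ≠ ∞ := by
    have : ∫⁻ y in Metric.closedBall (0 : E) 1, ENNReal.ofReal (inner ℝ y e) ≤
        ∫⁻ _ in Metric.closedBall (0 : E) 1, 1 := by
      refine setLIntegral_mono' measurableSet_closedBall fun y hy => ?_
      rw [← ENNReal.ofReal_one]
      refine ENNReal.ofReal_le_ofReal ((real_inner_le_norm y e).trans ?_)
      rw [he, mul_one]
      exact mem_closedBall_zero_iff.1 hy
    refine (this.trans_lt ?_).ne
    rw [setLIntegral_one]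
    exact measure_closedBall_lt_top
  have hlim : Tendsto (fun ε => parallelVolume W (T + ε)) (𝓝[>] 0) (𝓝 (parallelVolume W T)) := by
    have h := (tendsto_measure_cthickening_of_isCompact (μ := (volume : Measure E))
      (hWc.cthickening (r := T))).mono_left (nhdsWithin_le_nhds (s := Set.Ioi 0))
    have h2 := (ENNReal.tendsto_toReal (hWc.cthickening (r := T)).measure_lt_top.ne).comp h
    refine h2.congr' ?_
    filter_upwards [self_mem_nhdsWithin] with ε hε
    simp only [Function.comp, parallelVolume, measureReal_def]
    rw [cthickening_cthickening (le_of_lt hε) hT.le, add_comm]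
  have hlim2 := ENNReal.Tendsto.mul_const
    (b := ∫⁻ y in Metric.closedBall (0 : E) 1, ENNReal.ofReal (inner ℝ y e))
    (ENNReal.tendsto_ofReal (hlim.sub_const (parallelVolume W 0))) (Or.inr hfin)
  refine ge_of_tendsto hlim2 ?_
  filter_upwards [self_mem_nhdsWithin] with ε hε
  exact lintegral_shade_le_parallelVolume_add hWc hW hne he hT hε

end Cauchy

/-! ### Minkowski surface area bounds the mean projection -/

section Minkowski

variable {E : Type*} [NormedAddCommGroup E] [NormedSpace ℝ E]

/-- The parallel body of a convex body containing a ball of radius `ρ` lies in a homothetic copy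
of factor `1 + ε / ρ`. -/
lemma add_closedBall_subset_homothety {W : Set E} (hW : Convex ℝ W) {x₀ : E} {ρ ε : ℝ} (hρ : 0 < ρ)
    (hball : Metric.closedBall x₀ ρ ⊆ W) (hε : 0 < ε) :
    W + Metric.closedBall (0 : E) ε ⊆ (-(ε / ρ) • x₀) +ᵥ ((1 + ε / ρ) • W) := by
  rintro _ ⟨w, hw, b, hb, rfl⟩
  have hc : 0 < ε / ρ := by positivity
  have hz : x₀ + (ε / ρ)⁻¹ • b ∈ W := by
    apply hball
    rw [mem_closedBall_iff_norm, add_sub_cancel_left, norm_smul, norm_inv,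
      Real.norm_of_nonneg hc.le,
      inv_div, div_mul_eq_mul_div, div_le_iff₀ hε]
    exact mul_le_mul_of_nonneg_left (mem_closedBall_zero_iff.1 hb) hρ.le
  have hq := hW hw hz (a := 1 / (1 + ε / ρ)) (b := (ε / ρ) / (1 + ε / ρ)) (by positivity)
    (by positivity) (by field_simp)
  refine ⟨_, ⟨_, hq, rfl⟩, ?_⟩
  simp only [vadd_eq_add]
  match_scalars <;> field_simp
  ring

lemma one_add_pow_le_one_add_mul {x : ℝ} (hx0 : 0 ≤ x) (hx1 : x ≤ 1) (n : ℕ) :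
    (1 + x) ^ n ≤ 1 + x * (2 ^ n - 1) := by
  induction n with
  | zero => simp
  | succ n ih =>
    have h2 : (1 : ℝ) ≤ 2 ^ n := one_le_pow₀ one_le_two
    calc (1 + x) ^ (n + 1) = (1 + x) ^ n * (1 + x) := pow_succ _ _
      _ ≤ (1 + x * (2 ^ n - 1)) * (1 + x) := by gcongr
      _ ≤ 1 + x * (2 ^ (n + 1) - 1) := by
        rw [pow_succ]
        nlinarith [mul_nonneg hx0 (sub_nonneg.2 h2), mul_nonneg (mul_nonneg hx0 (sub_nonneg.2 h2))
          (sub_nonneg.2 hx1)]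

end Minkowski

section Surface

variable {W : Set (EuclideanSpace ℝ (Fin d))}

/-- The lower limit defining the surface area of a convex body is finite. -/
lemma liminf_surface_ne_top (hWc : IsCompact W) (hW : Convex ℝ W) (hvol : 0 < volume.real W) :
    liminf (fun ε : ℝ =>
      (volume (W + Metric.closedBall (0 : EuclideanSpace ℝ (Fin d)) ε) - volume W)
        / ENNReal.ofReal ε) (𝓝[>] 0) ≠ ∞ := by
  have hWfin : volume W ≠ ∞ := hWc.measure_lt_top.ne
  obtain ⟨x₀, hx₀⟩ : (interior W).Nonempty := by
    by_contra hcon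
    rw [Set.not_nonempty_iff_eq_empty] at hcon
    have h := hW.addHaar_frontier volume
    rw [frontier, hcon, Set.sdiff_empty, hWc.isClosed.closure_eq] at h
    simp [measureReal_def, h] at hvol
  obtain ⟨ρ, hρ, hball⟩ := Metric.nhds_basis_closedBall.mem_iff.1 (mem_interior_iff_mem_nhds.1 hx₀)
  set M : ℝ := (2 ^ d - 1) * volume.real W / ρ
  have hev : ∀ᶠ ε : ℝ in 𝓝[>] 0,
      (volume (W + Metric.closedBall (0 : EuclideanSpace ℝ (Fin d)) ε) - volume W)
        / ENNReal.ofReal ε ≤ ENNReal.ofReal M := by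
    filter_upwards [Ioc_mem_nhdsGT hρ] with ε hε
    have hε0 : 0 < ε := hε.1
    refine ENNReal.div_le_of_le_mul (tsub_le_iff_right.2 ?_)
    have h1 := measure_mono (μ := volume) (add_closedBall_subset_homothety hW hρ hball hε0)
    rw [measure_vadd, Measure.addHaar_smul, finrank_euclideanSpace, Fintype.card_fin,
      abs_of_nonneg (by positivity)] at h1
    refine h1.trans ?_
    rw [← ofReal_measureReal hWfin, ← ENNReal.ofReal_mul (by positivity), ← ENNReal.ofReal_mul'
      hε0.le, ← ENNReal.ofReal_add (by
        have : (1 : ℝ) ≤ 2 ^ d := one_le_pow₀ one_le_two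
        have : 0 ≤ (2 : ℝ) ^ d - 1 := by linarith
        positivity) (by positivity)]
    refine ENNReal.ofReal_le_ofReal ?_
    have h2 := one_add_pow_le_one_add_mul (x := ε / ρ) (by positivity)
      (div_le_one_of_le₀ hε.2 hρ.le) d
    calc (1 + ε / ρ) ^ d * volume.real W ≤ (1 + ε / ρ * (2 ^ d - 1)) * volume.real W := by gcongr
      _ = M * ε + volume.real W := by simp only [M]; ring
  have h := (liminf_le_liminf hev).trans_eq (liminf_const (f := 𝓝[>] (0 : ℝ)) (ENNReal.ofReal M))
  exact (h.trans_lt ENNReal.ofReal_lt_top).ne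

lemma surfaceArea_nonneg : 0 ≤ surfaceArea W := ENNReal.toReal_nonneg

/-- The integral of `‖y‖ ^ α` times the swept volume is at most what Cauchy's surface area formula
predicts. -/
lemma setLIntegral_rpow_norm_mul_shade_le (hd : 1 ≤ d) (hWc : IsCompact W) (hW : Convex ℝ W)
    (hvol : 0 < volume.real W) {α R : ℝ} (hα : -(d : ℝ) < α) (hR : 0 ≤ R) :
    ∫⁻ y in Metric.closedBall (0 : EuclideanSpace ℝ (Fin d)) R,
      ENNReal.ofReal (‖y‖ ^ α) * ENNReal.ofReal (shade W y) ≤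
      ENNReal.ofReal (kappa (d - 1) / (α + d + 1) * R ^ (α + d + 1) * surfaceArea W) := by
  have : Nonempty (Fin d) := ⟨⟨0, hd⟩⟩
  set i₀ : Fin d := ⟨0, hd⟩
  have hne : W.Nonempty := by
    by_contra hcon
    simp [Set.not_nonempty_iff_eq_empty.1 hcon] at hvol
  have hshade_meas : Measurable fun y => ENNReal.ofReal (shade W y) :=
    (measurable_shade hWc.isClosed).ennreal_ofReal
  have hshade_hom : ∀ (r : ℝ) (u : EuclideanSpace ℝ (Fin d)), 0 < r →
      ENNReal.ofReal (shade W (r • u)) = ENNReal.ofReal (r ^ 1) * ENNReal.ofReal (shade W u) := by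
    intro r u hr
    rw [shade_smul hWc hW u hr.le, pow_one, ENNReal.ofReal_mul hr.le]
  have hpolar := fun (α R : ℝ) (hR : 0 ≤ R)
      (hα : 0 < α + Module.finrank ℝ (EuclideanSpace ℝ (Fin d)) + (1 : ℕ)) =>
    setLIntegral_closedBall_rpow_norm_mul_homogeneous (volume : Measure (EuclideanSpace ℝ (Fin d)))
      1 hshade_meas hshade_hom (α := α) (R := R) hR hα
  simp only [finrank_euclideanSpace, Fintype.card_fin, Nat.cast_one] at hpolar
  set σ := ∫⁻ u : Metric.sphere (0 : EuclideanSpace ℝ (Fin d)) 1, ENNReal.ofReal (shade W u)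
    ∂(volume : Measure (EuclideanSpace ℝ (Fin d))).toSphere
  -- the same polar decomposition for the positive part of a coordinate
  have hcoord := setLIntegral_closedBall_rpow_norm_mul_homogeneous
    (volume : Measure (EuclideanSpace ℝ (Fin d))) 1
    (f := fun x => ENNReal.ofReal (x i₀)) (by fun_prop)
    (fun r u hr => by simp [ENNReal.ofReal_mul hr.le]) (α := 0) (R := 1) zero_le_one (by positivity)
  rw [lintegral_sphere_posPart_coord i₀] at hcoord
  have hball := hpolar 0 1 zero_le_one (by positivity)
  simp only [Real.rpow_zero, ENNReal.ofReal_one, one_mul, Real.one_rpow, zero_add,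
    finrank_euclideanSpace, Fintype.card_fin, Nat.cast_one] at hcoord hball
  have hdd : ENNReal.ofReal (1 / ((d : ℝ) + 1)) ≠ 0 := by
    simp only [ne_eq, ENNReal.ofReal_eq_zero, not_le]; positivity
  have hkpos : 0 < kappa (d - 1) := by
    rw [kappa_eq]
    exact div_pos (by positivity) (Real.Gamma_pos_of_pos (by positivity))
  have hk0 : ENNReal.ofReal (kappa (d - 1)) ≠ 0 := by simpa using hkpos
  have hσ : σ / ENNReal.ofReal (kappa (d - 1)) ≤ ENNReal.ofReal (surfaceArea W) := by
    rw [surfaceArea, ENNReal.ofReal_toReal (liminf_surface_ne_top hWc hW hvol)]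
    refine le_liminf_of_le (by isBoundedDefault) ?_
    filter_upwards [self_mem_nhdsWithin] with ε hε
    have hε0 : 0 < ε := hε
    have h := lintegral_shade_le_parallelVolume hWc hW hne
      (e := EuclideanSpace.single i₀ (1 : ℝ)) (by simp) hε0
    simp only [EuclideanSpace.inner_single_right, one_mul, conj_trivial] at h
    rw [hball, hcoord, mul_left_comm, mul_left_comm (ENNReal.ofReal (_ - _)),
      ENNReal.mul_le_mul_iff_right hdd ENNReal.ofReal_ne_top, parallelVolume_zero hWc,
      ENNReal.ofReal_sub _ measureReal_nonneg, parallelVolume,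
      ofReal_measureReal hWc.cthickening.measure_lt_top.ne,
      ofReal_measureReal hWc.measure_lt_top.ne, ← hWc.add_closedBall_zero hε0.le] at h
    refine ENNReal.div_le_of_le_mul ?_
    rw [div_eq_mul_inv, mul_right_comm, ← div_eq_mul_inv]
    rw [ENNReal.le_div_iff_mul_le (Or.inl (by simpa using hε0)) (Or.inl ENNReal.ofReal_ne_top),
      mul_comm]
    exact h
  have hσ' : σ ≤ ENNReal.ofReal (surfaceArea W) * ENNReal.ofReal (kappa (d - 1)) :=
    (ENNReal.div_le_iff hk0 ENNReal.ofReal_ne_top).1 hσ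
  have hα' : 0 < α + d + 1 := by linarith
  rw [hpolar α R hR hα']
  refine (mul_le_mul_right hσ' _).trans_eq ?_
  rw [← ENNReal.ofReal_mul surfaceArea_nonneg, ← ENNReal.ofReal_mul (by positivity)]
  congr 1
  ring

end Surface

/-! ### The covariogram near the origin -/

/-- A nonnegative subadditive function on the half line that is bounded by a linear function has a
right derivative at `0`. -/
lemma exists_tendsto_div_of_subadditive {f : ℝ → ℝ} {C : ℝ}
    (hsub : ∀ a b, 0 ≤ a → 0 ≤ b → f (a + b) ≤ f a + f b) (hnn : ∀ a, 0 ≤ a → 0 ≤ f a)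
    (hle : ∀ a, 0 ≤ a → f a ≤ C * a) :
    ∃ L, Tendsto (fun a => f a / a) (𝓝[>] 0) (𝓝 L) := by
  set S : Set ℝ := (fun a => f a / a) '' Set.Ioi 0 with hS
  have hbdd : BddAbove S := by
    refine ⟨C, ?_⟩
    rintro _ ⟨a, ha, rfl⟩
    exact (div_le_iff₀ ha).2 (hle a (le_of_lt ha))
  have hne : S.Nonempty := ⟨_, 1, Set.mem_Ioi.2 one_pos, rfl⟩
  have hnat : ∀ (n : ℕ) (a : ℝ), 0 ≤ a → f (n * a) ≤ n * f a := by
    intro n a ha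
    induction n with
    | zero =>
      have := hle 0 le_rfl
      simpa using this
    | succ n ih =>
      rw [Nat.cast_add, Nat.cast_one, add_mul, one_mul, add_mul, one_mul]
      exact (hsub _ _ (by positivity) ha).trans (by linarith)
  have hC : 0 ≤ C := by
    have := (hnn 1 zero_le_one).trans (hle 1 zero_le_one)
    linarith
  refine ⟨sSup S, tendsto_order.2 ⟨fun L hL => ?_, fun L hL => ?_⟩⟩
  · obtain ⟨_, ⟨a₀, ha₀, rfl⟩, hLa⟩ := exists_lt_of_lt_csSup hne hL
    have ha₀' : (0 : ℝ) < a₀ := ha₀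
    have hlim : Tendsto (fun a : ℝ => f a₀ / a₀ - C * a / a₀) (𝓝[>] 0) (𝓝 (f a₀ / a₀)) := by
      have : Tendsto (fun a : ℝ => f a₀ / a₀ - C * a / a₀) (𝓝 0) (𝓝 (f a₀ / a₀ - C * 0 / a₀)) :=
        Continuous.tendsto (by fun_prop) 0
      simpa using this.mono_left nhdsWithin_le_nhds
    filter_upwards [hlim.eventually_const_lt hLa, self_mem_nhdsWithin] with a hLa' ha
    have ha' : (0 : ℝ) < a := ha
    refine hLa'.trans_le ?_
    -- `a₀` is `n` steps of length `a` and a remainder shorter than `a`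
    set n := ⌊a₀ / a⌋₊
    have h1 : (n : ℝ) * a ≤ a₀ := (le_div_iff₀ ha').1 (Nat.floor_le (by positivity))
    have h2 : a₀ < (n + 1) * a := (div_lt_iff₀ ha').1 (Nat.lt_floor_add_one _)
    have h3 : f a₀ ≤ n * f a + C * a := by
      calc f a₀ = f (n * a + (a₀ - n * a)) := by ring_nf
        _ ≤ f (n * a) + f (a₀ - n * a) := hsub _ _ (by positivity) (by linarith)
        _ ≤ n * f a + C * (a₀ - n * a) := add_le_add (hnat n a ha'.le) (hle _ (by linarith))
        _ ≤ n * f a + C * a := by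
            have : C * (a₀ - n * a) ≤ C * a := by gcongr; linarith
            linarith
    rw [← sub_div, div_le_div_iff₀ ha₀' ha']
    have h4 := mul_le_mul_of_nonneg_right h1 (hnn a ha'.le)
    nlinarith
  · filter_upwards [self_mem_nhdsWithin] with a ha
    exact (le_csSup hbdd ⟨a, ha, rfl⟩).trans_lt hL

section Deficit

variable {W : Set (EuclideanSpace ℝ (Fin d))}

lemma covariogram_eq (W : Set (EuclideanSpace ℝ (Fin d))) (y : EuclideanSpace ℝ (Fin d)) :
    covariogram W y = volume.real (W ∩ (y +ᵥ W)) := by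
  have : (fun x => x + y) '' W = y +ᵥ W := by
    ext x; simp [Set.mem_vadd_set_iff_neg_vadd_mem, add_comm]
  rw [covariogram, this]

lemma covariogram_nonneg (W : Set (EuclideanSpace ℝ (Fin d))) (y : EuclideanSpace ℝ (Fin d)) :
    0 ≤ covariogram W y := measureReal_nonneg

lemma measurable_covariogram (hWc : IsCompact W) : Measurable (covariogram W) := by
  have hm : MeasurableSet {q : EuclideanSpace ℝ (Fin d) × EuclideanSpace ℝ (Fin d) |
      q.2 ∈ W ∧ q.2 - q.1 ∈ W} :=
    ((hWc.isClosed.preimage continuous_snd).inter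
      (hWc.isClosed.preimage (by fun_prop : Continuous fun q :
        EuclideanSpace ℝ (Fin d) × EuclideanSpace ℝ (Fin d) => q.2 - q.1))).measurableSet
  have h := (measurable_measure_prodMk_left (ν := volume) hm).ennreal_toReal
  convert! h using 2 with y
  rw [covariogram_eq, measureReal_def]
  congr 2
  ext x
  simp [Set.mem_vadd_set_iff_neg_vadd_mem, sub_eq_neg_add]

/-- The covariogram deficit `V(W) - g_W(y)`. -/
noncomputable def deficit (W : Set (EuclideanSpace ℝ (Fin d))) (y : EuclideanSpace ℝ (Fin d)) : ℝ :=
  volume.real W - covariogram W y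

lemma deficit_eq (hWc : IsCompact W) (y : EuclideanSpace ℝ (Fin d)) :
    deficit W y = volume.real ((y +ᵥ W) \ W) := by
  have hfin : volume (y +ᵥ W) ≠ ∞ := by
    rw [measure_vadd]; exact hWc.measure_lt_top.ne
  have h := measureReal_sdiff_add_inter (μ := volume) (s := y +ᵥ W) hWc.measurableSet hfin
  have h2 : volume.real (y +ᵥ W) = volume.real W := by simp [measureReal_def]
  rw [deficit, covariogram_eq, Set.inter_comm]
  linarith

lemma deficit_nonneg (hWc : IsCompact W) (y : EuclideanSpace ℝ (Fin d)) : 0 ≤ deficit W y := by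
  rw [deficit_eq hWc]; exact measureReal_nonneg

lemma measurable_deficit (hWc : IsCompact W) : Measurable (deficit W) :=
  (measurable_covariogram hWc).const_sub _

lemma deficit_le_shade (hWc : IsCompact W) (y : EuclideanSpace ℝ (Fin d)) :
    deficit W y ≤ shade W y := by
  rw [deficit_eq hWc]
  refine measureReal_mono (Set.sdiff_subset_sdiff_left ?_) (volume_sweep_diff_ne_top hWc y)
  rintro _ ⟨w, hw, rfl⟩
  exact ⟨w, hw, 1, by simp, by simp [add_comm]⟩

lemma deficit_add_le (hWc : IsCompact W) (x y : EuclideanSpace ℝ (Fin d)) :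
    deficit W (x + y) ≤ deficit W x + deficit W y := by
  have hfin : ∀ z : EuclideanSpace ℝ (Fin d), volume (z +ᵥ W) ≠ ∞ := fun z => by
    rw [measure_vadd]; exact hWc.measure_lt_top.ne
  have hsub : ((x + y) +ᵥ W) \ W ⊆ (y +ᵥ ((x +ᵥ W) \ W)) ∪ ((y +ᵥ W) \ W) := by
    rw [Set.vadd_set_sdiff, vadd_vadd, add_comm y x]
    intro z hz
    by_cases h : z ∈ y +ᵥ W
    · exact Or.inr ⟨h, hz.2⟩
    · exact Or.inl ⟨hz.1, h⟩
  have h1 : volume (y +ᵥ ((x +ᵥ W) \ W)) ≠ ∞ := by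
    rw [measure_vadd]; exact ((measure_mono Set.sdiff_subset).trans_lt (hfin x).lt_top).ne
  have h2 : volume ((y +ᵥ W) \ W) ≠ ∞ :=
    ((measure_mono Set.sdiff_subset).trans_lt (hfin y).lt_top).ne
  rw [deficit_eq hWc, deficit_eq hWc, deficit_eq hWc]
  refine (measureReal_mono hsub (measure_union_lt_top h1.lt_top h2.lt_top).ne).trans ?_
  refine (measureReal_union_le _ _).trans_eq ?_
  simp [measureReal_def]

/-- The covariogram has one-sided directional derivatives at the origin. -/
lemma exists_tendsto_deficit_smul_div (hWc : IsCompact W) (hW : Convex ℝ W)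
    (y : EuclideanSpace ℝ (Fin d)) :
    ∃ L, Tendsto (fun a : ℝ => deficit W (a • y) / a) (𝓝[>] 0) (𝓝 L) := by
  refine exists_tendsto_div_of_subadditive (C := shade W y) (fun a b _ _ => ?_)
    (fun a _ => deficit_nonneg hWc _) (fun a ha => ?_)
  · rw [add_smul]; exact deficit_add_le hWc _ _
  · rw [mul_comm, ← shade_smul hWc hW y ha]; exact deficit_le_shade hWc _

variable {α : ℝ}

/-- The integral of `‖y‖ ^ α` over a ball, in terms of the volume of the unit ball. -/
lemma integral_rpow_norm_closedBall (hd : 1 ≤ d) (hα : -(d : ℝ) < α) {R : ℝ} (hR : 0 ≤ R) :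
    IntegrableOn (fun y : EuclideanSpace ℝ (Fin d) => ‖y‖ ^ α) (Metric.closedBall 0 R) ∧
    ∫ y in Metric.closedBall (0 : EuclideanSpace ℝ (Fin d)) R, ‖y‖ ^ α =
      d * kappa d / (α + d) * R ^ (α + d) := by
  have : Nonempty (Fin d) := ⟨⟨0, hd⟩⟩
  have hpolar := fun (α R : ℝ) (hR : 0 ≤ R)
      (hα : 0 < α + Module.finrank ℝ (EuclideanSpace ℝ (Fin d)) + (0 : ℕ)) =>
    setLIntegral_closedBall_rpow_norm_mul_homogeneous (volume : Measure (EuclideanSpace ℝ (Fin d)))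
      0 (f := fun _ => 1) measurable_const (by simp) (α := α) (R := R) hR hα
  simp only [finrank_euclideanSpace, Fintype.card_fin, Nat.cast_zero, add_zero, mul_one,
    lintegral_one] at hpolar
  have hd' : (0 : ℝ) < d := by exact_mod_cast hd
  have hαd : 0 < α + d := by linarith
  have hκ : (volume : Measure (EuclideanSpace ℝ (Fin d))).toSphere Set.univ =
      ENNReal.ofReal (d * kappa d) := by
    have h := hpolar 0 1 zero_le_one (by simpa using hd')
    simp only [Real.rpow_zero, ENNReal.ofReal_one, zero_add, Real.one_rpow, setLIntegral_one] at h
    rw [ENNReal.ofReal_mul hd'.le, kappa, ofReal_measureReal measure_closedBall_lt_top.ne, h,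
      ← mul_assoc, ← ENNReal.ofReal_mul hd'.le, mul_one_div_cancel hd'.ne']
    simp
  have hl := hpolar α R hR hαd
  rw [hκ, ← ENNReal.ofReal_mul (by positivity)] at hl
  have hmeas : Measurable fun y : EuclideanSpace ℝ (Fin d) => ‖y‖ ^ α :=
    measurable_norm.pow_const α
  have hnn : ∀ y : EuclideanSpace ℝ (Fin d), 0 ≤ ‖y‖ ^ α := fun y =>
    Real.rpow_nonneg (norm_nonneg _) _
  constructor
  · refine ⟨hmeas.aestronglyMeasurable, ?_⟩
    rw [hasFiniteIntegral_iff_ofReal (Eventually.of_forall hnn), hl]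
    exact ENNReal.ofReal_lt_top
  · rw [integral_eq_lintegral_of_nonneg_ae (Eventually.of_forall hnn) hmeas.aestronglyMeasurable,
      hl, ENNReal.toReal_ofReal (mul_nonneg (by positivity) (mul_nonneg hd'.le (kappa_nonneg d)))]
    ring

lemma integral_rpow_norm_mul_shade_le (hd : 1 ≤ d) (hWc : IsCompact W) (hW : Convex ℝ W)
    (hvol : 0 < volume.real W) (hα : -(d : ℝ) < α) {R : ℝ} (hR : 0 ≤ R) :
    IntegrableOn (fun y => ‖y‖ ^ α * shade W y) (Metric.closedBall 0 R) ∧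
    ∫ y in Metric.closedBall (0 : EuclideanSpace ℝ (Fin d)) R, ‖y‖ ^ α * shade W y ≤
      kappa (d - 1) / (α + d + 1) * R ^ (α + d + 1) * surfaceArea W := by
  have hl := setLIntegral_rpow_norm_mul_shade_le hd hWc hW hvol hα hR
  have hmeas : Measurable fun y : EuclideanSpace ℝ (Fin d) => ‖y‖ ^ α * shade W y :=
    (measurable_norm.pow_const α).mul (measurable_shade hWc.isClosed)
  have hnn' : ∀ y : EuclideanSpace ℝ (Fin d), 0 ≤ ‖y‖ ^ α := fun y =>
    Real.rpow_nonneg (norm_nonneg _) _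
  have hnn : ∀ y : EuclideanSpace ℝ (Fin d), 0 ≤ ‖y‖ ^ α * shade W y :=
    fun y => mul_nonneg (hnn' y) (shade_nonneg _ _)
  simp_rw [← ENNReal.ofReal_mul (hnn' _)] at hl
  have hαd : 0 < α + d + 1 := by linarith
  constructor
  · refine ⟨hmeas.aestronglyMeasurable, ?_⟩
    rw [hasFiniteIntegral_iff_ofReal (Eventually.of_forall hnn)]
    exact hl.trans_lt ENNReal.ofReal_lt_top
  · rw [integral_eq_lintegral_of_nonneg_ae (Eventually.of_forall hnn) hmeas.aestronglyMeasurable]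
    refine ENNReal.toReal_le_of_le_ofReal ?_ hl
    exact mul_nonneg (mul_nonneg (div_nonneg (kappa_nonneg _) hαd.le) (by positivity))
      surfaceArea_nonneg

lemma integrableOn_rpow_norm_mul_deficit (hd : 1 ≤ d) (hWc : IsCompact W) (hW : Convex ℝ W)
    (hvol : 0 < volume.real W) (hα : -(d : ℝ) < α) {R : ℝ} (hR : 0 ≤ R) :
    IntegrableOn (fun y => ‖y‖ ^ α * deficit W y) (Metric.closedBall 0 R) := by
  refine (integral_rpow_norm_mul_shade_le hd hWc hW hvol hα hR).1.mono'
    ((measurable_norm.pow_const α).mul (measurable_deficit hWc)).aestronglyMeasurable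
    (Eventually.of_forall fun y => ?_)
  have h : 0 ≤ ‖y‖ ^ α := Real.rpow_nonneg (norm_nonneg _) _
  rw [Real.norm_of_nonneg (mul_nonneg h (deficit_nonneg hWc y))]
  exact mul_le_mul_of_nonneg_left (deficit_le_shade hWc y) h

/-- The covariogram integral as its leading term minus the integral of the deficit. -/
lemma integral_rpow_norm_mul_covariogram (hd : 1 ≤ d) (hWc : IsCompact W) (hW : Convex ℝ W)
    (hvol : 0 < volume.real W) (hα : -(d : ℝ) < α) {R : ℝ} (hR : 0 ≤ R) :
    IntegrableOn (fun y => ‖y‖ ^ α * covariogram W y) (Metric.closedBall 0 R) ∧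
    ∫ y in Metric.closedBall (0 : EuclideanSpace ℝ (Fin d)) R, ‖y‖ ^ α * covariogram W y =
      d * kappa d / (α + d) * R ^ (α + d) * volume.real W -
        ∫ y in Metric.closedBall (0 : EuclideanSpace ℝ (Fin d)) R, ‖y‖ ^ α * deficit W y := by
  obtain ⟨hi, hv⟩ := integral_rpow_norm_closedBall hd hα hR
  have hD := integrableOn_rpow_norm_mul_deficit hd hWc hW hvol hα hR
  have heq : (fun y => ‖y‖ ^ α * covariogram W y) =
      fun y => ‖y‖ ^ α * volume.real W - ‖y‖ ^ α * deficit W y := by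
    ext y; rw [deficit]; ring
  rw [heq]
  refine ⟨(hi.mul_const _).sub hD, ?_⟩
  rw [integral_sub (hi.mul_const _) hD, integral_mul_const, hv]

lemma integral_rpow_norm_mul_deficit_bounds (hd : 1 ≤ d) (hWc : IsCompact W) (hW : Convex ℝ W)
    (hvol : 0 < volume.real W) (hα : -(d : ℝ) < α) {R : ℝ} (hR : 0 ≤ R) :
    0 ≤ ∫ y in Metric.closedBall (0 : EuclideanSpace ℝ (Fin d)) R, ‖y‖ ^ α * deficit W y ∧
    ∫ y in Metric.closedBall (0 : EuclideanSpace ℝ (Fin d)) R, ‖y‖ ^ α * deficit W y ≤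
      kappa (d - 1) / (α + d + 1) * R ^ (α + d + 1) * surfaceArea W := by
  obtain ⟨hi, hle⟩ := integral_rpow_norm_mul_shade_le hd hWc hW hvol hα hR
  have h : ∀ y : EuclideanSpace ℝ (Fin d), 0 ≤ ‖y‖ ^ α := fun y =>
    Real.rpow_nonneg (norm_nonneg _) _
  refine ⟨integral_nonneg fun y => mul_nonneg (h y) (deficit_nonneg hWc y), le_trans ?_ hle⟩
  exact integral_mono (integrableOn_rpow_norm_mul_deficit hd hWc hW hvol hα hR) hi
    fun y => mul_le_mul_of_nonneg_left (deficit_le_shade hWc y) (h y)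

/-- The integral of the deficit over a ball of radius `R`, divided by `R ^ (α + d + 1)`, converges
as `R → 0`: rescale to the unit ball and apply dominated convergence with the directional
derivatives. -/
lemma exists_tendsto_integral_deficit_div (hd : 1 ≤ d) (hWc : IsCompact W) (hW : Convex ℝ W)
    (hvol : 0 < volume.real W) (hα : -(d : ℝ) < α) :
    ∃ c, Tendsto (fun R : ℝ =>
      (∫ y in Metric.closedBall (0 : EuclideanSpace ℝ (Fin d)) R, ‖y‖ ^ α * deficit W y) /
        R ^ (α + d + 1)) (𝓝[>] 0) (𝓝 c) := by
  choose L hL using exists_tendsto_deficit_smul_div hWc hW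
  have h0 : ∀ y : EuclideanSpace ℝ (Fin d), 0 ≤ ‖y‖ ^ α := fun y =>
    Real.rpow_nonneg (norm_nonneg _) _
  refine ⟨∫ z in Metric.closedBall (0 : EuclideanSpace ℝ (Fin d)) 1, ‖z‖ ^ α * L z, ?_⟩
  have hlim : Tendsto (fun R : ℝ => ∫ z in Metric.closedBall (0 : EuclideanSpace ℝ (Fin d)) 1,
      ‖z‖ ^ α * (deficit W (R • z) / R)) (𝓝[>] 0)
      (𝓝 (∫ z in Metric.closedBall (0 : EuclideanSpace ℝ (Fin d)) 1, ‖z‖ ^ α * L z)) := by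
    refine tendsto_integral_filter_of_dominated_convergence (fun z => ‖z‖ ^ α * shade W z) ?_ ?_
      (integral_rpow_norm_mul_shade_le hd hWc hW hvol hα zero_le_one).1 ?_
    · refine Eventually.of_forall fun R => Measurable.aestronglyMeasurable ?_
      exact (measurable_norm.pow_const α).mul
        (((measurable_deficit hWc).comp (measurable_const_smul R)).div_const R)
    · filter_upwards [self_mem_nhdsWithin] with R hR
      have hR' : (0 : ℝ) < R := hR
      refine Eventually.of_forall fun z => ?_
      rw [Real.norm_of_nonneg (mul_nonneg (h0 z) (div_nonneg (deficit_nonneg hWc _) hR'.le))]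
      refine mul_le_mul_of_nonneg_left ?_ (h0 z)
      rw [div_le_iff₀ hR', mul_comm, ← shade_smul hWc hW z hR'.le]
      exact deficit_le_shade hWc _
    · exact Eventually.of_forall fun z => (hL z).const_mul _
  refine hlim.congr' ?_
  filter_upwards [self_mem_nhdsWithin] with R hR
  have hR' : (0 : ℝ) < R := hR
  have h := Measure.setIntegral_comp_smul (volume : Measure (EuclideanSpace ℝ (Fin d)))
    (fun y => ‖y‖ ^ α * deficit W y) (Metric.closedBall 0 1) hR'.ne'
  rw [smul_closedBall _ _ zero_le_one, smul_zero, mul_one, Real.norm_of_nonneg hR'.le,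
    finrank_euclideanSpace, Fintype.card_fin, abs_of_nonneg (by positivity), smul_eq_mul] at h
  have h2 : ∫ y in Metric.closedBall (0 : EuclideanSpace ℝ (Fin d)) R, ‖y‖ ^ α * deficit W y =
      R ^ d * ∫ z in Metric.closedBall (0 : EuclideanSpace ℝ (Fin d)) 1,
        ‖R • z‖ ^ α * deficit W (R • z) := by
    rw [h]; field_simp
  rw [h2, Real.rpow_add hR', Real.rpow_add hR', Real.rpow_one, Real.rpow_natCast, mul_div_assoc,
    ← integral_div, ← integral_const_mul]
  refine setIntegral_congr_fun measurableSet_closedBall fun z _ => ?_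
  have hRα : 0 < R ^ α := Real.rpow_pos_of_pos hR' α
  simp only [norm_smul, Real.norm_of_nonneg hR'.le]
  rw [Real.mul_rpow hR'.le (norm_nonneg z)]
  field_simp

end Deficit

/-! ### The expectation of the length-power functional -/

section Expectation

variable {W : Set (EuclideanSpace ℝ (Fin d))}

/-- Integrating a function of the difference of two points of `W` produces the covariogram. -/
lemma lintegral_prod_restrict_sub (hWc : IsCompact W) {k : EuclideanSpace ℝ (Fin d) → ℝ≥0∞}
    (hk : Measurable k) :
    ∫⁻ p, k (p.1 - p.2) ∂((volume.restrict W).prod (volume.restrict W)) =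
      ∫⁻ z, k z * ENNReal.ofReal (covariogram W z) := by
  have hWm := hWc.measurableSet
  have hind : Measurable (W.indicator (1 : EuclideanSpace ℝ (Fin d) → ℝ≥0∞)) :=
    measurable_one.indicator hWm
  calc ∫⁻ p, k (p.1 - p.2) ∂((volume.restrict W).prod (volume.restrict W))
      = ∫⁻ y in W, ∫⁻ x in W, k (x - y) :=
        lintegral_prod_symm' _ (by fun_prop)
    _ = ∫⁻ y in W, ∫⁻ z, W.indicator 1 (z + y) * k z := by
        refine lintegral_congr fun y => ?_
        rw [← lintegral_indicator hWm, ← lintegral_add_right_eq_self _ y]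
        refine lintegral_congr fun z => ?_
        by_cases h : z + y ∈ W <;> simp [h]
    _ = ∫⁻ z, ∫⁻ y in W, W.indicator 1 (z + y) * k z := by
        refine lintegral_lintegral_swap ?_
        exact ((hind.comp (measurable_snd.add measurable_fst)).mul
          (hk.comp measurable_snd)).aemeasurable
    _ = ∫⁻ z, k z * ENNReal.ofReal (covariogram W z) := by
        refine lintegral_congr fun z => ?_
        have hm : Measurable fun y => W.indicator (1 : EuclideanSpace ℝ (Fin d) → ℝ≥0∞) (z + y) :=
          hind.comp (measurable_const_add z)
        have hcov : (z +ᵥ W) ∩ W = (fun y => -z + y) ⁻¹' ((fun y => z + y) ⁻¹' W ∩ W) := by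
          ext x
          simp [Set.mem_vadd_set_iff_neg_vadd_mem, and_comm]
        rw [lintegral_mul_const _ hm, mul_comm, covariogram_eq, Set.inter_comm, ofReal_measureReal
          ((measure_mono Set.inter_subset_right).trans_lt hWc.measure_lt_top).ne, hcov,
          measure_preimage_add]
        congr 1
        have : (fun y => W.indicator (1 : EuclideanSpace ℝ (Fin d) → ℝ≥0∞) (z + y)) =
            ((fun y => z + y) ⁻¹' W).indicator 1 := rfl
        rw [this, lintegral_indicator_one (measurable_const_add z hWm),
          Measure.restrict_apply (measurable_const_add z hWm)]

variable {Ω : Type*} [MeasurableSpace Ω] {P : Measure Ω} [IsProbabilityMeasure P]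
  {t : ℝ} {η : Ω → PointConfig W} {α : ℝ}

/-- The expected length-power functional of a Poisson process is finite and given by an integral of
the covariogram. -/
lemma IsPoissonProcess.integral_lengthPower (hη : IsPoissonProcess P W t η) (hd : 1 ≤ d)
    (hWc : IsCompact W) (hW : Convex ℝ W) (hvol : 0 < volume.real W) (ht : 0 < t)
    (hα : -(d : ℝ) < α) {r : ℝ} (hr : 0 ≤ r) :
    Integrable (fun ω => lengthPower α r (η ω)) P ∧
    ∫ ω, lengthPower α r (η ω) ∂P =
      t ^ 2 / 2 * ∫ y in Metric.closedBall (0 : EuclideanSpace ℝ (Fin d)) r,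
        ‖y‖ ^ α * covariogram W y := by
  have h0 : ∀ y : EuclideanSpace ℝ (Fin d), 0 ≤ ‖y‖ ^ α := fun y =>
    Real.rpow_nonneg (norm_nonneg _) _
  set K : EuclideanSpace ℝ (Fin d) → ℝ := (Metric.closedBall 0 r).indicator fun y => ‖y‖ ^ α with hK
  have hKm : Measurable fun y => ENNReal.ofReal (K y) :=
    ((measurable_norm.pow_const α).indicator measurableSet_closedBall).ennreal_ofReal
  have hK0 : ∀ y, 0 ≤ K y := fun y => Set.indicator_nonneg (fun y _ => h0 y) y
  have hKm2 : Measurable fun p : EuclideanSpace ℝ (Fin d) × EuclideanSpace ℝ (Fin d) =>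
      ENNReal.ofReal (K (p.1 - p.2)) := hKm.comp (measurable_fst.sub measurable_snd)
  have hsum : ∀ ω, lengthPower α r (η ω) =
      (1 / 2 * ∫⁻ p, ENNReal.ofReal (K (p.1 - p.2)) ∂(pairMeasure (η ω).1)).toReal := by
    classical
    intro ω
    rw [lintegral_pairMeasure _ hKm2, ← ENNReal.ofReal_sum_of_nonneg fun p _ => hK0 _,
      ENNReal.toReal_mul, ENNReal.toReal_ofReal (Finset.sum_nonneg fun p _ => hK0 _), lengthPower]
    congr 1
    · simp
    · refine Finset.sum_congr (by congr!) fun p _ => ?_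
      simp [hK, Set.indicator_apply]
  have hm : Measurable fun ω => ∫⁻ p, ENNReal.ofReal (K (p.1 - p.2)) ∂(pairMeasure (η ω).1) :=
    (Measure.measurable_lintegral hKm2).comp ((measurable_pairMeasure hWc.measurableSet).comp
      hη.measurable)
  obtain ⟨hgi, -⟩ := integral_rpow_norm_mul_covariogram hd hWc hW hvol hα hr
  have hnn : ∀ y, 0 ≤ ‖y‖ ^ α * covariogram W y := fun y =>
    mul_nonneg (h0 y) (covariogram_nonneg W y)
  have hE : ∫⁻ ω, 1 / 2 * ∫⁻ p, ENNReal.ofReal (K (p.1 - p.2)) ∂(pairMeasure (η ω).1) ∂P =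
      ENNReal.ofReal (t ^ 2 / 2 * ∫ y in Metric.closedBall (0 : EuclideanSpace ℝ (Fin d)) r,
        ‖y‖ ^ α * covariogram W y) := by
    rw [lintegral_const_mul _ hm, hη.lintegral_sum_offDiag hWc hd ht hKm2,
      lintegral_prod_restrict_sub hWc hKm, ENNReal.ofReal_mul (by positivity),
      ofReal_integral_eq_lintegral_ofReal hgi (Eventually.of_forall hnn), ← mul_assoc]
    congr 1
    · rw [ENNReal.ofReal_div_of_pos two_pos, ENNReal.ofReal_pow ht.le, ENNReal.ofReal_ofNat,
        one_div, mul_comm, div_eq_mul_inv]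
    · rw [← lintegral_indicator measurableSet_closedBall]
      refine lintegral_congr fun y => ?_
      by_cases hy : y ∈ Metric.closedBall (0 : EuclideanSpace ℝ (Fin d)) r
      · rw [Set.indicator_of_mem hy, ← ENNReal.ofReal_mul (hK0 y), hK, Set.indicator_of_mem hy]
      · rw [Set.indicator_of_notMem hy, hK, Set.indicator_of_notMem hy]
        simp
  have hfin : ∫⁻ ω, 1 / 2 * ∫⁻ p, ENNReal.ofReal (K (p.1 - p.2)) ∂(pairMeasure (η ω).1) ∂P ≠ ∞ := by
    rw [hE]; exact ENNReal.ofReal_ne_top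
  simp_rw [hsum]
  refine ⟨integrable_toReal_of_lintegral_ne_top (hm.const_mul _).aemeasurable hfin, ?_⟩
  rw [integral_toReal (hm.const_mul _).aemeasurable (ae_lt_top (hm.const_mul _) hfin), hE,
    ENNReal.toReal_ofReal (mul_nonneg (by positivity) (integral_nonneg hnn))]

end Expectation

end Gilbert

theorem theorem2p1 {d : ℕ} (hd : 1 ≤ d)
    (W : Set (EuclideanSpace ℝ (Fin d))) (hWcompact : IsCompact W) (hWconvex : Convex ℝ W)
    (hWvol : 0 < volume.real W)
    {Ω : Type*} [MeasurableSpace Ω] (P : Measure Ω) [IsProbabilityMeasure P]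
    (η : ℝ → Ω → Gilbert.PointConfig W)
    (hη : ∀ t : ℝ, 0 < t → Gilbert.IsPoissonProcess P W t (η t))
    (δ : ℝ → ℝ) (hδpos : ∀ t : ℝ, 0 < t → 0 < δ t) (hδ : Tendsto δ atTop (𝓝 0))
    (α : ℝ) (hα : -(d : ℝ) < α) :
    (∀ t : ℝ, 0 < t →
      Integrable (fun ω => Gilbert.lengthPower α (δ t) (η t ω)) P ∧
      IntegrableOn (fun y : EuclideanSpace ℝ (Fin d) => ‖y‖ ^ α * Gilbert.covariogram W y)
        (Metric.closedBall 0 (δ t)) ∧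
      ∫ ω, Gilbert.lengthPower α (δ t) (η t ω) ∂P =
        t ^ 2 / 2 * ∫ y in Metric.closedBall (0 : EuclideanSpace ℝ (Fin d)) (δ t),
          ‖y‖ ^ α * Gilbert.covariogram W y ∧
      d * Gilbert.kappa d / (2 * (α + d)) * t ^ 2 * δ t ^ (α + d) * volume.real W
          - Gilbert.kappa (d - 1) / (2 * (α + d + 1)) * t ^ 2 * δ t ^ (α + d + 1)
            * Gilbert.surfaceArea W
        ≤ ∫ ω, Gilbert.lengthPower α (δ t) (η t ω) ∂P ∧
      ∫ ω, Gilbert.lengthPower α (δ t) (η t ω) ∂P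
        ≤ d * Gilbert.kappa d / (2 * (α + d)) * t ^ 2 * δ t ^ (α + d) * volume.real W) ∧
    ∃ R : ℝ → ℝ, Gilbert.LandauO R δ ∧ ∀ t : ℝ, 0 < t →
      ∫ ω, Gilbert.lengthPower α (δ t) (η t ω) ∂P =
        d * Gilbert.kappa d / (2 * (α + d)) * t ^ 2 * δ t ^ (α + d) * volume.real W
          * (1 + R t) := by
  have hd' : (0 : ℝ) < d := by exact_mod_cast hd
  have hαd : 0 < α + d := by linarith
  have hκ : 0 < Gilbert.kappa d := by
    rw [Gilbert.kappa_eq]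
    exact div_pos (by positivity) (Real.Gamma_pos_of_pos (by positivity))
  set J : ℝ → ℝ := fun R => ∫ y in Metric.closedBall (0 : EuclideanSpace ℝ (Fin d)) R,
    ‖y‖ ^ α * Gilbert.deficit W y with hJ
  have hE : ∀ t : ℝ, 0 < t → ∫ ω, Gilbert.lengthPower α (δ t) (η t ω) ∂P =
      t ^ 2 / 2 * (d * Gilbert.kappa d / (α + d) * δ t ^ (α + d) * volume.real W - J (δ t)) := by
    intro t ht
    rw [((hη t ht).integral_lengthPower hd hWcompact hWconvex hWvol ht hα (hδpos t ht).le).2,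
      (Gilbert.integral_rpow_norm_mul_covariogram hd hWcompact hWconvex hWvol hα
        (hδpos t ht).le).2]
  refine ⟨fun t ht => ?_, ?_⟩
  · have hδt := (hδpos t ht).le
    obtain ⟨hi, hv⟩ := (hη t ht).integral_lengthPower hd hWcompact hWconvex hWvol ht hα hδt
    obtain ⟨hJ0, hJ1⟩ :=
      Gilbert.integral_rpow_norm_mul_deficit_bounds hd hWcompact hWconvex hWvol hα hδt
    refine ⟨hi, (Gilbert.integral_rpow_norm_mul_covariogram hd hWcompact hWconvex hWvol hα hδt).1,
      hv, ?_, ?_⟩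
    · rw [hE t ht]
      have hα1 : 0 < α + d + 1 := by linarith
      calc _ = t ^ 2 / 2 * (d * Gilbert.kappa d / (α + d) * δ t ^ (α + d) * volume.real W -
            Gilbert.kappa (d - 1) / (α + d + 1) * δ t ^ (α + d + 1) * Gilbert.surfaceArea W) := by
            field_simp
        _ ≤ _ := mul_le_mul_of_nonneg_left (sub_le_sub_left hJ1 _) (by positivity)
    · rw [hE t ht]
      calc _ ≤ t ^ 2 / 2 * (d * Gilbert.kappa d / (α + d) * δ t ^ (α + d) * volume.real W) :=
            mul_le_mul_of_nonneg_left (sub_le_self _ hJ0) (by positivity)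
        _ = _ := by field_simp
  · obtain ⟨c, hc⟩ :=
      Gilbert.exists_tendsto_integral_deficit_div hd hWcompact hWconvex hWvol hα
    set A : ℝ := d * Gilbert.kappa d / (α + d) * volume.real W with hA
    have hApos : 0 < A := by positivity
    refine ⟨fun t => -(J (δ t) / δ t ^ (α + d)) / A, ⟨-c / A, ?_⟩, fun t ht => ?_⟩
    · have hδ' : Tendsto δ atTop (𝓝[>] 0) :=
        tendsto_nhdsWithin_iff.2 ⟨hδ, (eventually_gt_atTop 0).mono hδpos⟩
      refine ((hc.comp hδ').neg.div_const A).congr' ?_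
      filter_upwards [eventually_gt_atTop 0] with t ht
      have hpos := hδpos t ht
      have hpow : 0 < δ t ^ (α + d) := Real.rpow_pos_of_pos hpos _
      simp only [Function.comp]
      rw [Real.rpow_add_one hpos.ne', ← div_div]
      ring
    · have hpow : 0 < δ t ^ (α + d) := Real.rpow_pos_of_pos (hδpos t ht) _
      rw [hE t ht, hA]
      field_simp
      ring
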